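/- Let $\mathbb F_q$ be a finite field with $q$ elements, $\mathbb R_\infty=\mathbb F_q((1/\theta))$, and let $\mathbb C_\infty$ be the completion of an algebraic closure of $\mathbb R_\infty$. Let $\mathbb C_\infty[T,\tau]$ be the Anderson ring ($aT=Ta$, $\tau T=T\tau$, $\tau a=a^q\tau$ for $a\in\mathbb C_\infty$). For a vector $Z$ let $Z^{(k)}$ be the vector of the $q^k$-th powers of its entries. An Anderson t-motive of rank $r$ and dimension $n$ is a left $\mathbb C_\infty[T,\tau]$-module $M$, free of rank $r$ over $\mathbb C_\infty[T]$ and free of rank $n$ over $\mathbb C_\infty\{\tau\}$, with $T-\theta$ nilpotent on $M/\tau M$. If $e_*$ is a $\mathbb C_\infty\{\tau\}$-basis of $M$ with $Te_*=\theta e_*+A_1\tau e_*+\dots+A_k\tau^k e_*$, put $T(Z)=\theta Z+A_1Z^{(1)}+\dots+A_kZ^{(k)}$ on $\mathbb C_\infty^n$, let $\exp_M(Z)=Z+C_1Z^{(1)}+C_2Z^{(2)}+\cdots$ be the unique everywhere convergent series with $\exp_M(\theta Z)=T(\exp_M(Z))$, and let $L(M)=\operatorname{Ker}\exp_M\subset\mathbb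 C_\infty^n$, an $\mathbb F_q[\theta]$-module. $M$ is called uniformizable if the dimension of $L(M)$ over $\mathbb F_q[\theta]$ is $r$. A lattice of rank $r$ in $\mathbb C_\infty^n$ is an $\mathbb F_q[\theta]$-submodule $L\cong\mathbb F_q[\theta]^r$ whose $\mathbb C_\infty$-span is $\mathbb C_\infty^n$ and a basis of which is linearly independent over $\mathbb R_\infty$. Two lattices are isomorphic if a $\mathbb C_\infty$-linear isomorphism of the ambient spaces maps one onto the other. A matrix $S\in M_{(r-n)\times n}(\mathbb C_\infty)$ is a Siegel matrix of $L$ if $L$ has an $\mathbb F_q[\theta]$-basis $l_1,\dots,l_r$ such that $l_1,\dots,l_n$ is a $\mathbb C_\infty$-basis of $\mathbb C_\infty^n$ and $(l_{n+1},\dots,l_r)^t=S\,(l_1,\dots,l_n)^t$. Let $\mathfrak C$ be the Carlitz module ($Te=\theta e+\tau e$), $\mathfrak C_2$ the Carlitz module of rank 2 ($Te=\theta e+\tau^2e$), and for $a\in\mathbb C_\infty$ let $M(a)$ be the module with $\mathbb C_\infty\{\tau\}$-basis $e_1,e_2$ and $$T\begin{pmatrix}e_1\\e_2\end{pmatrix}=\theta\begin{pmatrix}e_1\\e_2\end{pmatrix}+\begin{pmatrix}0&a\\0&1\end{pmatrix}\tau\begin{pmatrix}e_1\\e_2\end{pmatrix}+\begin{pmatrix}1&0\\0&0\end{pmatrix}\tau^2\begin{pmatrix}e_1\\e_2\end{pmatrix}.$$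 Let $L_0=L(\mathfrak C_2\oplus\mathfrak C)$. **Proposition 2.4.** For every $a\in\mathbb C_\infty$, $M(a)$ is an Anderson t-motive of rank 3 and dimension 2, and there is an exact sequence $0\to\mathfrak C\to M(a)\to\mathfrak C_2\to0$ of $\mathbb C_\infty[T,\tau]$-modules. $L_0$ is a lattice of rank 3 in $\mathbb C_\infty^2$, and for every $\omega\in\mathbb F_{q^2}\setminus\mathbb F_q$ the matrix $(0,\omega)$ is a Siegel matrix of $L_0$. There exists a neighbourhood $U$ of $0$ in $\mathbb C_\infty$ such that for every $a\in U$ the t-motive $M(a)$ is uniformizable, and $L(M(a))$ is a lattice of rank 3 isomorphic to $L_0$. -/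

import Mathlib

open Polynomial Topology
open scoped Polynomial NNReal

noncomputable section

namespace TMot

/-! ### The fields `ℝ_∞` and `ℂ_∞`

`Fq` is a finite field, `q` is its number of elements. -/

/-- `ℝ_∞ = F_q((1/θ))`: the formal Laurent series in the variable `1/θ`. -/
def Rinf (Fq : Type*) [Field Fq] : Type _ := LaurentSeries Fq

section Fields

variable (Fq : Type*) [Field Fq]

instance : Field (Rinf Fq) := inferInstanceAs (Field (LaurentSeries Fq))

instance : Algebra Fq (Rinf Fq) := inferInstanceAs (Algebra Fq (LaurentSeries Fq))

/-- The valuation at infinity (the variable of the Laurent series is `1/θ`). -/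
instance : Valued (Rinf Fq) (WithZero (Multiplicative ℤ)) :=
  inferInstanceAs (Valued (LaurentSeries Fq) (WithZero (Multiplicative ℤ)))

instance : CompleteSpace (Rinf Fq) := inferInstanceAs (CompleteSpace (LaurentSeries Fq))

instance : (Valued.v : Valuation (Rinf Fq) (WithZero (Multiplicative ℤ))).IsRankOneDiscrete := by
  change ((PowerSeries.idealX Fq).valuation (LaurentSeries Fq)).IsRankOneDiscrete
  infer_instance

variable [Fintype Fq]

/-- The absolute value of `ℝ_∞` is normalized by `|θ| = q`. -/
instance : (Valued.v : Valuation (Rinf Fq) (WithZero (Multiplicative ℤ))).RankOne :=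
  Valuation.IsRankOneDiscrete.rankOne (e := (Fintype.card Fq : ℝ≥0)) Valued.v
    (by exact_mod_cast Fintype.one_lt_card)

instance : NontriviallyNormedField (Rinf Fq) :=
  Valued.toNontriviallyNormedField (Rinf Fq) (WithZero (Multiplicative ℤ))

open scoped Valued in
instance : IsUltrametricDist (Rinf Fq) := inferInstance

/-- The algebraic closure of `ℝ_∞`, with the unique extension of the absolute value. -/
def RinfAlg : Type _ := AlgebraicClosure (Rinf Fq)

instance : Field (RinfAlg Fq) := inferInstanceAs (Field (AlgebraicClosure (Rinf Fq)))

instance : Algebra (Rinf Fq) (RinfAlg Fq) :=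
  inferInstanceAs (Algebra (Rinf Fq) (AlgebraicClosure (Rinf Fq)))

instance : IsAlgClosure (Rinf Fq) (RinfAlg Fq) :=
  inferInstanceAs (IsAlgClosure (Rinf Fq) (AlgebraicClosure (Rinf Fq)))

instance : Algebra.IsAlgebraic (Rinf Fq) (RinfAlg Fq) :=
  inferInstanceAs (Algebra.IsAlgebraic (Rinf Fq) (AlgebraicClosure (Rinf Fq)))

instance : NontriviallyNormedField (RinfAlg Fq) :=
  spectralNorm.nontriviallyNormedField (Rinf Fq) (RinfAlg Fq)

instance : NormedAlgebra (Rinf Fq) (RinfAlg Fq) :=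
  spectralNorm.normedAlgebra (Rinf Fq) (RinfAlg Fq)

/-- `ℂ_∞`: the completion of the algebraic closure of `ℝ_∞`. -/
def Cinf : Type _ := UniformSpace.Completion (RinfAlg Fq)

instance : NormedField (Cinf Fq) :=
  inferInstanceAs (NormedField (UniformSpace.Completion (RinfAlg Fq)))

instance : CompleteSpace (Cinf Fq) :=
  inferInstanceAs (CompleteSpace (UniformSpace.Completion (RinfAlg Fq)))

instance : NormedAlgebra (Rinf Fq) (Cinf Fq) :=
  inferInstanceAs (NormedAlgebra (Rinf Fq) (UniformSpace.Completion (RinfAlg Fq)))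

instance : Algebra Fq (Cinf Fq) :=
  ((algebraMap (Rinf Fq) (Cinf Fq)).comp (algebraMap Fq (Rinf Fq))).toAlgebra

instance : NontriviallyNormedField (Cinf Fq) where
  non_trivial := by
    obtain ⟨x, hx⟩ := NontriviallyNormedField.non_trivial (α := Rinf Fq)
    exact ⟨algebraMap (Rinf Fq) (Cinf Fq) x, by rwa [norm_algebraMap']⟩

/-- The element `θ` of `ℂ_∞`: the inverse of the Laurent series variable. -/
def theta : Cinf Fq :=
  algebraMap (Rinf Fq) (Cinf Fq) (HahnSeries.single (-1 : ℤ) (1 : Fq) : LaurentSeries Fq)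

/-- The ring `F_q[θ] ⊂ ℂ_∞`. -/
abbrev FqTheta : Subalgebra Fq (Cinf Fq) := Algebra.adjoin Fq {theta Fq}

variable {Fq} in
/-- The `k`-th iterate of the `q`-Frobenius, `z ↦ z ^ (q ^ k)`, on vectors. -/
def frobVec {ι : Type*} (k : ℕ) (Z : ι → Cinf Fq) : ι → Cinf Fq :=
  fun i => Z i ^ Fintype.card Fq ^ k

variable {Fq} in
theorem add_pow_frob (k : ℕ) (x y : Cinf Fq) :
    (x + y) ^ Fintype.card Fq ^ k = x ^ Fintype.card Fq ^ k + y ^ Fintype.card Fq ^ k := by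
  induction k with
  | zero => simp
  | succ k ih =>
    rw [pow_succ, pow_mul, pow_mul, pow_mul, ih]
    exact map_add (FiniteField.frobeniusAlgHom Fq (Cinf Fq)) _ _

/-- `ℕ` acts on `ℂ_∞` through the powers of the `q`-Frobenius, so that
in `SkewPolynomial (Cinf Fq)` the variable `τ` satisfies `τ a = a ^ q τ`. -/
instance : MulSemiringAction (Multiplicative ℕ) (Cinf Fq) where
  smul k x := x ^ Fintype.card Fq ^ k.toAdd
  one_smul x := by
    change x ^ Fintype.card Fq ^ 0 = x
    simp
  mul_smul j k x := by
    change x ^ Fintype.card Fq ^ (j.toAdd + k.toAdd) =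
      (x ^ Fintype.card Fq ^ k.toAdd) ^ Fintype.card Fq ^ j.toAdd
    rw [← pow_mul, ← pow_add, add_comm]
  smul_zero k := by
    change (0 : Cinf Fq) ^ Fintype.card Fq ^ k.toAdd = 0
    exact zero_pow (pow_ne_zero _ Fintype.card_ne_zero)
  smul_add k x y := add_pow_frob k.toAdd x y
  smul_one k := one_pow _
  smul_mul k x y := mul_pow x y _

end Fields

/-! ### The Anderson ring and t-motives -/

section Motives

variable (Fq : Type*) [Field Fq] [Fintype Fq]

/-- The twisted polynomial ring `ℂ_∞{τ}`, with `τ a = a ^ q τ`. -/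
abbrev Twisted : Type _ := SkewPolynomial (Cinf Fq)

/-- The Anderson ring `ℂ_∞[T, τ]`: polynomials in a variable `T` commuting with the coefficients,
which are in `ℂ_∞{τ}`. -/
abbrev AndersonRing : Type _ := Polynomial (Twisted Fq)

/-- The inclusion of `ℂ_∞[T]` in `ℂ_∞[T, τ]`. -/
def inclT : Polynomial (Cinf Fq) →+* AndersonRing Fq :=
  Polynomial.mapRingHom SkewPolynomial.CRingHom

/-- `τ ∈ ℂ_∞{τ}`. -/
def tau : Twisted Fq := SkewPolynomial.X

/-- `T ∈ ℂ_∞[T, τ]`. -/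
def T : AndersonRing Fq := Polynomial.X

variable {Fq}

/-- A constant of `ℂ_∞`, as an element of `ℂ_∞{τ}`. -/
def const (c : Cinf Fq) : Twisted Fq := SkewPolynomial.CRingHom c

section General

/-- `M` is free of rank `r` over `ℂ_∞[T]`. -/
def FreeOfRankT (Fq : Type*) [Field Fq] [Fintype Fq]
    (M : Type*) [AddCommGroup M] [Module (AndersonRing Fq) M] (r : ℕ) : Prop :=
  letI : Module (Polynomial (Cinf Fq)) M := Module.compHom M (inclT Fq)
  Nonempty (Module.Basis (Fin r) (Polynomial (Cinf Fq)) M)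

/-- The left `ℂ_∞[T, τ]`-module `M` is an Anderson t-motive of rank `r` and dimension `n`. -/
structure IsTMotive (Fq : Type*) [Field Fq] [Fintype Fq]
    (M : Type*) [AddCommGroup M] [Module (Twisted Fq) M] [Module (AndersonRing Fq) M]
    [IsScalarTower (Twisted Fq) (AndersonRing Fq) M] (r n : ℕ) : Prop where
  free_T : FreeOfRankT Fq M r
  free_tau : Nonempty (Module.Basis (Fin n) (Twisted Fq) M)
  /-- `T - θ` acts nilpotently on `M / τ M`. -/
  nilpotent : ∃ k : ℕ, ∀ m : M, ∃ m' : M,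
    (T Fq - Polynomial.C (const (theta Fq))) ^ k • m = tau Fq • m'

variable {M : Type*} [AddCommGroup M] [Module (Twisted Fq) M] [Module (AndersonRing Fq) M]
  {ι : Type*} [Fintype ι] [DecidableEq ι]

/-- The matrix `A₀ + A₁ τ + ⋯ + A_k τ ^ k` over `ℂ_∞{τ}` with `T e_* = (A₀ + A₁ τ + ⋯) e_*`. -/
def matT (e : Module.Basis ι (Twisted Fq) M) : Matrix ι ι (Twisted Fq) :=
  Matrix.of fun j k => e.repr (T Fq • e j) k

/-- The value `∑ cᵢ z ^ (q ^ i)` at `z ∈ ℂ_∞` of the twisted polynomial `∑ cᵢ τ ^ i`. -/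
def twistedEval (f : Twisted Fq) (z : Cinf Fq) : Cinf Fq :=
  SkewPolynomial.sum f fun i c => c * z ^ Fintype.card Fq ^ i

/-- The action `T(Z) = A₀ Z + A₁ Z⁽¹⁾ + ⋯ + A_k Z⁽ᵏ⁾` of `T` on `ℂ_∞ⁿ` in the basis `e`. -/
def actT (e : Module.Basis ι (Twisted Fq) M) (Z : ι → Cinf Fq) : ι → Cinf Fq :=
  fun j => ∑ k, twistedEval (matT e j k) (Z k)

/-- `E` is the exponential of `M` in the basis `e`: it is given on all of `ℂ_∞ⁿ` by a convergent
series `Z + C₁ Z⁽¹⁾ + C₂ Z⁽²⁾ + ⋯`, and `E (θ Z) = T (E Z)`. This is the notion for t-motives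
whose matrix `A₀` is the scalar matrix `θ`. -/
def IsExp (e : Module.Basis ι (Twisted Fq) M) (E : (ι → Cinf Fq) → (ι → Cinf Fq)) : Prop :=
  (∃ C : ℕ → Matrix ι ι (Cinf Fq), C 0 = 1 ∧
    ∀ Z, HasSum (fun m => (C m).mulVec (frobVec m Z)) (E Z)) ∧
  ∀ Z, E (theta Fq • Z) = actT e (E Z)

open Classical in
/-- The exponential of `M` in the basis `e`. For t-motives with scalar matrix `A₀ = θ` it exists and
is unique, so that the default value `0` is not used. -/
def expMap (e : Module.Basis ι (Twisted Fq) M) : (ι → Cinf Fq) → (ι → Cinf Fq) :=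
  if h : ∃ E, IsExp e E then h.choose else fun _ => 0

theorem IsExp.map_zero {e : Module.Basis ι (Twisted Fq) M} {E : (ι → Cinf Fq) → (ι → Cinf Fq)}
    (h : IsExp e E) : E 0 = 0 := by
  obtain ⟨⟨C, -, hC⟩, -⟩ := h
  refine (hC 0).unique ?_
  have : (fun m => (C m).mulVec (frobVec m (0 : ι → Cinf Fq))) = fun _ => 0 := by
    funext m
    have : frobVec m (0 : ι → Cinf Fq) = 0 := by
      funext i
      exact zero_pow (pow_ne_zero _ Fintype.card_ne_zero)
    rw [this, Matrix.mulVec_zero]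
  rw [this]
  exact hasSum_zero

theorem IsExp.map_add {e : Module.Basis ι (Twisted Fq) M} {E : (ι → Cinf Fq) → (ι → Cinf Fq)}
    (h : IsExp e E) (Y Z : ι → Cinf Fq) : E (Y + Z) = E Y + E Z := by
  obtain ⟨⟨C, -, hC⟩, -⟩ := h
  refine (hC (Y + Z)).unique ?_
  have : (fun m => (C m).mulVec (frobVec m (Y + Z))) =
      fun m => (C m).mulVec (frobVec m Y) + (C m).mulVec (frobVec m Z) := by
    funext m
    have : frobVec m (Y + Z) = frobVec m Y + frobVec m Z := by
      funext i
      exact add_pow_frob m (Y i) (Z i)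
    rw [this, Matrix.mulVec_add]
  rw [this]
  exact (hC Y).add (hC Z)

theorem IsExp.map_smul {e : Module.Basis ι (Twisted Fq) M} {E : (ι → Cinf Fq) → (ι → Cinf Fq)}
    (h : IsExp e E) (c : Fq) (Z : ι → Cinf Fq) :
    E (algebraMap Fq (Cinf Fq) c • Z) = algebraMap Fq (Cinf Fq) c • E Z := by
  obtain ⟨⟨C, -, hC⟩, -⟩ := h
  refine (hC _).unique ?_
  have : (fun m => (C m).mulVec (frobVec m (algebraMap Fq (Cinf Fq) c • Z))) =
      fun m => algebraMap Fq (Cinf Fq) c • (C m).mulVec (frobVec m Z) := by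
    funext m
    have : frobVec m (algebraMap Fq (Cinf Fq) c • Z) =
        algebraMap Fq (Cinf Fq) c • frobVec m Z := by
      funext i
      simp only [frobVec, Pi.smul_apply, smul_eq_mul, mul_pow]
      rw [← map_pow, FiniteField.pow_card_pow]
    rw [this, Matrix.mulVec_smul]
  rw [this]
  exact (hC Z).const_smul _

theorem IsExp.smul_mem {e : Module.Basis ι (Twisted Fq) M} {E : (ι → Cinf Fq) → (ι → Cinf Fq)}
    (h : IsExp e E) (c : FqTheta Fq) (Z : ι → Cinf Fq) (hZ : E Z = 0) : E (c • Z) = 0 := by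
  obtain ⟨c, hc⟩ := c
  change E (c • Z) = 0
  induction hc using Algebra.adjoin_induction generalizing Z with
  | mem x hx =>
    rw [Set.mem_singleton_iff.1 hx, h.2, hZ]
    funext j
    refine Finset.sum_eq_zero fun k _ => ?_
    simp only [twistedEval, SkewPolynomial.sum_def]
    refine Finset.sum_eq_zero fun i _ => ?_
    rw [Pi.zero_apply, zero_pow (pow_ne_zero _ Fintype.card_ne_zero), mul_zero]
  | algebraMap r => rw [h.map_smul, hZ, smul_zero]
  | add x y _ _ hx hy => rw [add_smul, h.map_add, hx Z hZ, hy Z hZ, add_zero]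
  | mul x y _ _ hx hy => rw [mul_smul]; exact hx _ (hy Z hZ)

/-- The `F_q[θ]`-module `L(M) ⊂ ℂ_∞ⁿ`: the kernel of the exponential of `M` in the basis `e`. -/
def lattice (e : Module.Basis ι (Twisted Fq) M) : Submodule (FqTheta Fq) (ι → Cinf Fq) where
  carrier := {Z | expMap e Z = 0}
  zero_mem' := by
    change expMap e 0 = 0
    unfold expMap
    split_ifs with h
    · exact h.choose_spec.map_zero
    · rfl
  add_mem' {Y Z} hY hZ := by
    change expMap e (Y + Z) = 0
    change expMap e Y = 0 at hY
    change expMap e Z = 0 at hZ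
    unfold expMap at hY hZ ⊢
    split_ifs at hY hZ ⊢ with h
    · rw [h.choose_spec.map_add, hY, hZ, add_zero]
    · rfl
  smul_mem' c Z hZ := by
    change expMap e (c • Z) = 0
    change expMap e Z = 0 at hZ
    unfold expMap at hZ ⊢
    split_ifs at hZ ⊢ with h
    · exact h.choose_spec.smul_mem c Z hZ
    · rfl

/-- `M` is uniformizable: the dimension over `F_q[θ]` of its lattice (in the basis `e`)
is the rank `r` of `M` over `ℂ_∞[T]`. -/
def IsUniformizable (e : Module.Basis ι (Twisted Fq) M) : Prop :=
  ∃ r : ℕ, FreeOfRankT Fq M r ∧ Module.rank (FqTheta Fq) (lattice e) = r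

end General

/-! ### Lattices -/

section Lattices

variable {ι κ : Type*} [Fintype ι]

/-- `L ⊂ ℂ_∞ⁿ` is a lattice of rank `r`: it is isomorphic to `F_q[θ]ʳ`, it spans `ℂ_∞ⁿ` over
`ℂ_∞`, and an `F_q[θ]`-basis of it is linearly independent over `ℝ_∞`. -/
def IsLattice (L : Submodule (FqTheta Fq) (ι → Cinf Fq)) (r : ℕ) : Prop :=
  Submodule.span (Cinf Fq) (L : Set (ι → Cinf Fq)) = ⊤ ∧
  ∃ b : Module.Basis (Fin r) (FqTheta Fq) L,
    LinearIndependent (Rinf Fq) fun i => (b i : ι → Cinf Fq)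

/-- Isomorphism of lattices: a `ℂ_∞`-linear isomorphism of the ambient spaces maps one to the
other. -/
def LatticeIso (L : Submodule (FqTheta Fq) (ι → Cinf Fq))
    (L' : Submodule (FqTheta Fq) (κ → Cinf Fq)) : Prop :=
  ∃ φ : (ι → Cinf Fq) ≃ₗ[Cinf Fq] (κ → Cinf Fq),
    φ '' (L : Set (ι → Cinf Fq)) = (L' : Set (κ → Cinf Fq))

/-- `S` is the Siegel matrix of `L` in some `F_q[θ]`-basis `b` of `L`: the first part
`v₁, …, v_n` of `b` is a `ℂ_∞`-basis of the ambient space, and the rows of `S` are the coordinates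
of the remaining elements of `b` in it. -/
def HasSiegelMatrix {n m : ℕ} (L : Submodule (FqTheta Fq) (ι → Cinf Fq))
    (S : Matrix (Fin m) (Fin n) (Cinf Fq)) : Prop :=
  ∃ (b : Module.Basis (Fin n ⊕ Fin m) (FqTheta Fq) L)
    (v : Module.Basis (Fin n) (Cinf Fq) (ι → Cinf Fq)),
    (∀ i, v i = (b (Sum.inl i) : ι → Cinf Fq)) ∧
    ∀ k, (b (Sum.inr k) : ι → Cinf Fq) = ∑ i, S k i • v i

end Lattices

/-! ### The t-motives given by an explicit formula for `T e_*` -/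

section Explicit

variable {ι : Type*} [Fintype ι]

/-- The free left `ℂ_∞{τ}`-module with basis `e_*`, on which `T` acts by `T e_* = P e_*`. -/
def Motive (_P : Matrix ι ι (Twisted Fq)) : Type _ := ι → Twisted Fq

variable (P : Matrix ι ι (Twisted Fq))

instance : AddCommGroup (Motive P) := inferInstanceAs (AddCommGroup (ι → Twisted Fq))

instance : Module (Twisted Fq) (Motive P) := inferInstanceAs (Module (Twisted Fq) (ι → Twisted Fq))

/-- The `ℂ_∞{τ}`-linear action of `T`: the row `(m_j)`, that is `∑ m_j e_j`, is mapped to the row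
`m P`, that is `∑ m_j (T e_j)`. -/
def Motive.mulT : Motive P →ₗ[Twisted Fq] Motive P :=
  (Matrix.vecMulLinear P : (ι → Twisted Fq) →ₗ[Twisted Fq] (ι → Twisted Fq))

/-- The same map, as an additive endomorphism. -/
def Motive.endT : AddMonoid.End (Motive P) := (Motive.mulT P).toAddMonoidHom

/-- The action of `ℂ_∞[T, τ]`. -/
def Motive.act : AndersonRing Fq →+* AddMonoid.End (Motive P) :=
  Polynomial.eval₂RingHom' (Module.toAddMonoidEnd (Twisted Fq) (Motive P))
    (Motive.endT P) fun a => by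
      ext m
      exact ((Motive.mulT P).map_smul a m).symm

instance : Module (AndersonRing Fq) (Motive P) := Module.compHom _ (Motive.act P)

theorem Motive.smul_def (f : AndersonRing Fq) (m : Motive P) : f • m = Motive.act P f m := rfl

theorem Motive.C_smul (a : Twisted Fq) (m : Motive P) :
    (Polynomial.C a : AndersonRing Fq) • m = a • m := by
  have h : Motive.act P (Polynomial.C a) = Module.toAddMonoidEnd (Twisted Fq) (Motive P) a :=
    Polynomial.eval₂_C _ _
  rw [Motive.smul_def, h]
  rfl

theorem Motive.T_smul (m : Motive P) : T Fq • m = Motive.mulT P m := by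
  have h : Motive.act P (T Fq) = Motive.endT P := Polynomial.eval₂_X _ _
  rw [Motive.smul_def, h]
  rfl

instance : IsScalarTower (Twisted Fq) (AndersonRing Fq) (Motive P) where
  smul_assoc a f m := by
    rw [Polynomial.smul_eq_C_mul, mul_smul, Motive.C_smul]

/-- The basis `e_*`. -/
def Motive.basis : Module.Basis ι (Twisted Fq) (Motive P) :=
  Module.Basis.ofEquivFun (LinearEquiv.refl (Twisted Fq) (ι → Twisted Fq))

variable (Fq)

/-- The Carlitz module: `T e = θ e + τ e`. -/
abbrev Carlitz : Type _ := Motive (Fq := Fq) (ι := Fin 1) !![const (theta Fq) + tau Fq]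

/-- The Carlitz module of rank 2: `T e = θ e + τ ^ 2 e`. -/
abbrev Carlitz2 : Type _ := Motive (Fq := Fq) (ι := Fin 1) !![const (theta Fq) + tau Fq ^ 2]

/-- The basis of `Carlitz2 Fq × Carlitz Fq` made of the basis elements of the two factors. -/
def basis0 : Module.Basis (Fin 1 ⊕ Fin 1) (Twisted Fq) (Carlitz2 Fq × Carlitz Fq) :=
  (Motive.basis _).prod (Motive.basis _)

/-- The lattice `L₀` of `Carlitz2 Fq × Carlitz Fq`. -/
def L0 : Submodule (FqTheta Fq) (Fin 1 ⊕ Fin 1 → Cinf Fq) := lattice (basis0 Fq)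

variable {Fq}

/-- The t-motive `M(a)`:
`T e₁ = θ e₁ + a τ e₂ + τ ^ 2 e₁` and `T e₂ = θ e₂ + τ e₂`. -/
abbrev Ma (a : Cinf Fq) : Type _ :=
  Motive (Fq := Fq) (ι := Fin 2)
    !![const (theta Fq) + tau Fq ^ 2, const a * tau Fq; 0, const (theta Fq) + tau Fq]

/-- The basis `e₁, e₂` of `M(a)` over `ℂ_∞{τ}`. -/
def basisMa (a : Cinf Fq) : Module.Basis (Fin 2) (Twisted Fq) (Ma a) := Motive.basis _

end Explicit

end Motives

end TMot

end

/-! On `M(a)` the action of T is triangular, so its exponential is triangular too: (Z₁, Z₂) ↦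
(e₂(Z₁) + f(Z₂), e₁(Z₂)). Here e_s (`carlitzExp`) is the exponential of T e = θ e + τ^s e, and f
(`extExp`) satisfies f(θz) = θ f(z) + f(z)^(q²) + a e₁(z)^q. Comparing coefficients puts all three
series under one recursion (`recCoeff`). Its denominators θ^(q^m) - θ are so large that the series
converge everywhere (`norm_recCoeff_le`).

The zeros of e_s come from a nonzero ρ with ρ^(q^s) = -θρ. On the ball of radius |ρ| the map e_s is
an isometric perturbation of the identity, hence onto, so ρ = e_s(η) and ϖ_s = θη is a period. A
descent dividing by θ shows that every zero is a multiple of ϖ_s by a polynomial in θ over the field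
with q^s elements (`exists_period`).

If e₂(x) = -f(ϖ₁), the kernel is generated over F_q[θ] by v₀ = (x, ϖ₁), v₁ = (ϖ₂, 0) and ω v₁
(`IsExtensionBasis.isFramed`). Such an x exists as soon as |f(ϖ₁)| ≤ |ρ₂|, where ρ₂ is the ρ for s =
2. Since |f(ϖ₁)| is at most a constant times |a| when |a| ≤ 1, this holds near a = 0. The shape v₀,
v₁, ω v₁ does not involve a, and `L0` is the case a = 0, so the linear map matching the v's matches
the lattices (`IsFramed.latticeIso`). Independence over ℝ_∞ amounts to ω ∉ ℝ_∞.

As `expMap` is defined by choice, the explicit exponential is tied to it by uniqueness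
(`IsExp.unique`). On the algebraic side, e₁, τ e₁, e₂ is a basis over ℂ_∞[T], and T - θ kills M / τ
M because ℂ_∞ is perfect. -/

noncomputable section

set_option linter.unusedSectionVars false

namespace TMot

/-! ### Convergent `q`-power series over a complete ultrametric field -/

section Series

variable {Fq : Type*} [Field Fq] [Fintype Fq]
variable {K : Type*} [NormedField K] [Algebra Fq K]

local notation "q" => Fintype.card Fq

variable (Fq) in
theorem add_pow_card_pow (k : ℕ) (x y : K) :
    (x + y) ^ q ^ k = x ^ q ^ k + y ^ q ^ k := by
  induction k with
  | zero => simp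
  | succ k ih =>
    rw [pow_succ, pow_mul, pow_mul, pow_mul, ih]
    exact map_add (FiniteField.frobeniusAlgHom Fq K) _ _

variable (Fq) in
theorem one_lt_card_pow {k : ℕ} (hk : k ≠ 0) : 1 < q ^ k :=
  Nat.one_lt_pow hk Fintype.one_lt_card

variable (Fq K) in
/-- The additive endomorphism `x ↦ x ^ (q ^ k)`. -/
def powHom (k : ℕ) : K →+ K where
  toFun x := x ^ q ^ k
  map_zero' := zero_pow (pow_ne_zero _ Fintype.card_ne_zero)
  map_add' := add_pow_card_pow Fq k

theorem powHom_apply (k : ℕ) (x : K) : powHom Fq K k x = x ^ q ^ k := rfl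

variable (Fq) in
theorem sub_pow_card_pow (k : ℕ) (x y : K) :
    (x - y) ^ q ^ k = x ^ q ^ k - y ^ q ^ k :=
  map_sub (powHom Fq K k) x y

variable (Fq) in
/-- The `q`-power series with coefficients `x` converges everywhere. -/
def IsEntire (x : ℕ → K) : Prop :=
  ∀ z : K, Filter.Tendsto (fun m => x m * z ^ q ^ m) Filter.atTop (𝓝 0)

variable (Fq) in
/-- The sum of the `q`-power series with coefficients `x`. -/
def frobSeries (x : ℕ → K) (z : K) : K := ∑' m, x m * z ^ q ^ m

/-- The m-th term is at most B (N^(-h m) ‖z‖)^(q^m), and the base is eventually below 1/2 because h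
tends to infinity. -/
theorem isEntire_of_norm_le {x : ℕ → K} {B N : ℝ} (hN : 1 < N) {h : ℕ → ℕ}
    (hh : Filter.Tendsto h Filter.atTop Filter.atTop)
    (hx : ∀ m, ‖x m‖ ≤ B * (N⁻¹ ^ h m) ^ q ^ m) : IsEntire Fq x := by
  intro z
  have hN0 : (0 : ℝ) < N := by linarith
  have hB : 0 ≤ B := by
    have h0 := (norm_nonneg _).trans (hx 0)
    exact nonneg_of_mul_nonneg_left h0 (by positivity)
  have h1 : Filter.Tendsto (fun m => N⁻¹ ^ h m * ‖z‖) Filter.atTop (𝓝 0) := by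
    have := ((tendsto_pow_atTop_nhds_zero_of_lt_one (inv_nonneg.2 hN0.le)
      (inv_lt_one_of_one_lt₀ hN)).comp hh).mul_const ‖z‖
    simpa using this
  have h2 : ∀ᶠ m in Filter.atTop, N⁻¹ ^ h m * ‖z‖ ≤ 1 / 2 :=
    (h1.eventually_lt_const (by norm_num)).mono fun _ h => h.le
  have h3 : Filter.Tendsto (fun m : ℕ => B * (1 / 2 : ℝ) ^ m) Filter.atTop (𝓝 0) := by
    simpa using (tendsto_pow_atTop_nhds_zero_of_lt_one (by norm_num : (0 : ℝ) ≤ 1 / 2)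
      (by norm_num)).const_mul B
  refine squeeze_zero_norm' ?_ h3
  filter_upwards [h2] with m hm
  have hq : m ≤ q ^ m := (Nat.lt_pow_self Fintype.one_lt_card).le
  calc ‖x m * z ^ q ^ m‖ = ‖x m‖ * ‖z‖ ^ q ^ m := by rw [norm_mul, norm_pow]
    _ ≤ B * (N⁻¹ ^ h m) ^ q ^ m * ‖z‖ ^ q ^ m := by gcongr; exact hx m
    _ = B * (N⁻¹ ^ h m * ‖z‖) ^ q ^ m := by rw [mul_pow, mul_assoc]
    _ ≤ B * (1 / 2) ^ q ^ m := by gcongr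
    _ ≤ B * (1 / 2) ^ m := by
      gcongr 1
      exact pow_le_pow_of_le_one (by norm_num) (by norm_num) hq

theorem frobSeries_zero (x : ℕ → K) : frobSeries Fq x 0 = 0 := by
  simp [frobSeries, zero_pow (pow_ne_zero _ Fintype.card_ne_zero)]

variable [CompleteSpace K] [IsUltrametricDist K]

theorem IsEntire.hasSum {x : ℕ → K} (hx : IsEntire Fq x) (z : K) :
    HasSum (fun m => x m * z ^ q ^ m) (frobSeries Fq x z) :=
  (NonarchimedeanAddGroup.summable_of_tendsto_cofinite_zero
    (by rw [Nat.cofinite_eq_atTop]; exact hx z)).hasSum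

theorem IsEntire.add {x : ℕ → K} (hx : IsEntire Fq x) (y z : K) :
    frobSeries Fq x (y + z) = frobSeries Fq x y + frobSeries Fq x z := by
  refine (hx.hasSum (y + z)).unique ?_
  simp only [add_pow_card_pow Fq, mul_add]
  exact (hx.hasSum y).add (hx.hasSum z)

theorem IsEntire.sub {x : ℕ → K} (hx : IsEntire Fq x) (y z : K) :
    frobSeries Fq x (y - z) = frobSeries Fq x y - frobSeries Fq x z := by
  rw [eq_sub_iff_add_eq, ← hx.add, sub_add_cancel]

/-- A series in `z ^ (q ^ (s k))`, `k ≥ 0`, is linear over the field with `q ^ s` elements. -/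
theorem IsEntire.mul_of_dvd {x : ℕ → K} (hx : IsEntire Fq x) {s : ℕ}
    (hs : ∀ m, ¬ s ∣ m → x m = 0) {c : K} (hc : c ^ q ^ s = c) (z : K) :
    frobSeries Fq x (c * z) = c * frobSeries Fq x z := by
  refine (hx.hasSum (c * z)).unique ?_
  refine ((hx.hasSum z).mul_left c).congr_fun ?_
  intro m
  by_cases hm : s ∣ m
  · obtain ⟨k, rfl⟩ := hm
    have : c ^ q ^ (s * k) = c := by
      induction k with
      | zero => simp
      | succ k ih => rw [mul_add, mul_one, pow_add, pow_mul, ih, hc]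
    rw [mul_pow, this]; ring
  · simp [hs m hm]

theorem norm_frobSeries_le {x : ℕ → K} {z : K} {B : ℝ}
    (h : ∀ m, ‖x m * z ^ q ^ m‖ ≤ B) : ‖frobSeries Fq x z‖ ≤ B :=
  IsUltrametricDist.norm_tsum_le_of_forall_le h

theorem IsEntire.norm_sub_le {x : ℕ → K} (hx : IsEntire Fq x) {z : K} {B : ℝ}
    (h : ∀ m, m ≠ 0 → ‖x m * z ^ q ^ m‖ ≤ B) : ‖frobSeries Fq x z - x 0 * z‖ ≤ B := by
  have h1 := (hasSum_nat_add_iff' 1).2 (hx.hasSum z)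
  simp only [Finset.sum_range_one, pow_zero, pow_one] at h1
  rw [← h1.tsum_eq]
  exact IsUltrametricDist.norm_tsum_le_of_forall_le fun m => h _ (by omega)

/-! ### The recursion for the coefficients -/

variable (Fq) in
/-- The solution of `x m (θ ^ (q ^ m) - θ) = x (m - s) ^ (q ^ s) + b m`, with `x 0 = x₀`. -/
def recCoeff (θ : K) (s : ℕ) (x₀ : K) (b : ℕ → K) (m : ℕ) : K :=
  if m = 0 then x₀ else
    ((if _h : 0 < s ∧ s ≤ m then recCoeff θ s x₀ b (m - s) ^ q ^ s else 0) + b m) /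
      (θ ^ q ^ m - θ)
termination_by m
decreasing_by omega

theorem recCoeff_zero (θ : K) (s : ℕ) (x₀ : K) (b : ℕ → K) : recCoeff Fq θ s x₀ b 0 = x₀ := by
  rw [recCoeff, if_pos rfl]

theorem recCoeff_add (θ : K) {s : ℕ} (hs : 0 < s) (x₀ : K) (b : ℕ → K) (m : ℕ) :
    recCoeff Fq θ s x₀ b (m + s) =
      (recCoeff Fq θ s x₀ b m ^ q ^ s + b (m + s)) / (θ ^ q ^ (m + s) - θ) := by
  rw [recCoeff, if_neg (by omega), dif_pos ⟨hs, by omega⟩, Nat.add_sub_cancel]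

theorem recCoeff_of_lt (θ : K) {s : ℕ} (x₀ : K) (b : ℕ → K) {m : ℕ} (hm : m < s) (h0 : m ≠ 0) :
    recCoeff Fq θ s x₀ b m = b m / (θ ^ q ^ m - θ) := by
  rw [recCoeff, if_neg h0, dif_neg (by omega), zero_add]

/-- Without a forcing term the recursion joins only indices congruent mod s, and only the class of 0
has a nonzero start. This feeds `IsEntire.mul_of_dvd`. -/
theorem recCoeff_eq_zero (θ : K) {s : ℕ} (hs : 0 < s) (x₀ : K) (m : ℕ) (h : ¬ s ∣ m) :
    recCoeff Fq θ s x₀ 0 m = 0 := by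
  induction m using Nat.strong_induction_on with
  | _ m ih =>
    rcases lt_or_ge m s with hm | hm
    · rw [recCoeff_of_lt θ x₀ 0 hm (by rintro rfl; simp at h)]; simp
    · obtain ⟨k, rfl⟩ := Nat.exists_eq_add_of_le' hm
      rw [recCoeff_add θ hs, ih k (by omega) (by simpa using h)]
      simp [zero_pow (pow_ne_zero _ Fintype.card_ne_zero)]

variable {θ : K} (hθ : 1 < ‖θ‖)
include hθ

theorem norm_pow_sub_self {m : ℕ} (hm : m ≠ 0) : ‖θ ^ q ^ m - θ‖ = ‖θ‖ ^ q ^ m := by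
  have h : ‖θ‖ < ‖θ ^ q ^ m‖ := by
    rw [norm_pow]
    exact lt_self_pow₀ hθ (one_lt_card_pow Fq hm)
  rw [sub_eq_add_neg, IsUltrametricDist.norm_add_eq_max_of_norm_ne_norm (by rw [norm_neg]; exact h.ne'),
    norm_neg, max_eq_left h.le, norm_pow]

theorem pow_sub_self_ne_zero {m : ℕ} (hm : m ≠ 0) : θ ^ q ^ m - θ ≠ 0 := by
  rw [← norm_pos_iff, norm_pow_sub_self hθ hm]
  positivity

/-- The denominator has norm ‖θ‖^(q^m), so each step of length s raises the exponent m / s by one.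
The step also replaces B by B^(q^s), which `B ≤ 1` absorbs. -/
theorem norm_recCoeff_le {s : ℕ} (hs : 0 < s) {x₀ : K} {b : ℕ → K} {B : ℝ} (hB : B ≤ 1)
    (hx₀ : ‖x₀‖ ≤ B)
    (hb : ∀ m, m ≠ 0 → ‖b m‖ ≤ B * (‖θ‖⁻¹ ^ (m / s)) ^ q ^ m * ‖θ‖ ^ q ^ m) (m : ℕ) :
    ‖recCoeff Fq θ s x₀ b m‖ ≤ B * (‖θ‖⁻¹ ^ (m / s)) ^ q ^ m := by
  have hN : 0 < ‖θ‖ := by linarith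
  have hB0 : 0 ≤ B := (norm_nonneg _).trans hx₀
  induction m using Nat.strong_induction_on with
  | _ m ih =>
    rcases eq_or_ne m 0 with rfl | h0
    · simpa [recCoeff_zero] using hx₀
    rcases lt_or_ge m s with hm | hm
    · rw [recCoeff_of_lt θ x₀ b hm h0, norm_div, norm_pow_sub_self hθ h0,
        div_le_iff₀ (by positivity)]
      exact hb m h0
    · obtain ⟨k, rfl⟩ := Nat.exists_eq_add_of_le' hm
      rw [recCoeff_add θ hs, norm_div, norm_pow_sub_self hθ h0, div_le_iff₀ (by positivity)]
      refine (IsUltrametricDist.norm_add_le_max _ _).trans (max_le ?_ (hb _ h0))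
      have h1 : (k + s) / s = k / s + 1 := Nat.add_div_right k hs
      have h2 : (‖θ‖⁻¹ ^ (k / s + 1)) ^ q ^ (k + s) * ‖θ‖ ^ q ^ (k + s) =
          ((‖θ‖⁻¹ ^ (k / s)) ^ q ^ k) ^ q ^ s := by
        rw [← mul_pow, pow_succ, mul_assoc, inv_mul_cancel₀ hN.ne', mul_one, pow_add, pow_mul]
      rw [h1, mul_assoc, h2, norm_pow]
      calc ‖recCoeff Fq θ s x₀ b k‖ ^ q ^ s
          ≤ (B * (‖θ‖⁻¹ ^ (k / s)) ^ q ^ k) ^ q ^ s := by gcongr; exact ih k (by omega)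
        _ = B ^ q ^ s * ((‖θ‖⁻¹ ^ (k / s)) ^ q ^ k) ^ q ^ s := mul_pow _ _ _
        _ ≤ B * ((‖θ‖⁻¹ ^ (k / s)) ^ q ^ k) ^ q ^ s := by
          gcongr
          exact pow_le_of_le_one hB0 hB (pow_ne_zero _ Fintype.card_ne_zero)

/-- The functional equation of the series given by the recursion. -/
theorem frobSeries_recCoeff_mul {s : ℕ} (hs : 0 < s) {x₀ : K} {b : ℕ → K} (hb0 : b 0 = 0)
    (hx : IsEntire Fq (recCoeff Fq θ s x₀ b)) {z β : K}
    (hb : HasSum (fun m => b m * z ^ q ^ m) β) :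
    frobSeries Fq (recCoeff Fq θ s x₀ b) (θ * z) =
      θ * frobSeries Fq (recCoeff Fq θ s x₀ b) z +
        frobSeries Fq (recCoeff Fq θ s x₀ b) z ^ q ^ s + β := by
  set x := recCoeff Fq θ s x₀ b with hxdef
  have h1 : HasSum (fun m => (x m * z ^ q ^ m) ^ q ^ s) (frobSeries Fq x z ^ q ^ s) :=
    (hx.hasSum z).map (powHom Fq K s) (continuous_pow _)
  -- The power q^s moves the m-th term to index m + s; the shifted series is padded by zeros below
  -- s.
  have h2 : HasSum (fun m => if s ≤ m then (x (m - s) * z ^ q ^ (m - s)) ^ q ^ s else 0)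
      (frobSeries Fq x z ^ q ^ s) := by
    rw [← (add_left_injective s).hasSum_iff]
    · refine h1.congr_fun ?_
      intro m
      simp
    · intro m hm
      refine if_neg fun h => hm ⟨m - s, ?_⟩
      simp [h]
  refine (hx.hasSum (θ * z)).unique ?_
  refine ((((hx.hasSum z).mul_left θ).add h2).add hb).congr_fun ?_
  intro m
  -- At m = 0 the factor θ^(q^m) - θ vanishes: the equation leaves `x 0` free and forces `b 0 = 0`.
  rcases eq_or_ne m 0 with rfl | h0
  · rw [if_neg (by omega), hb0]
    simp only [pow_zero, pow_one]; ring
  have hne := pow_sub_self_ne_zero (Fq := Fq) hθ h0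
  rcases lt_or_ge m s with hm | hm
  · have h3 : x m * (θ ^ q ^ m - θ) = b m := by
      rw [hxdef, recCoeff_of_lt θ x₀ b hm h0, div_mul_cancel₀ _ hne]
    rw [if_neg (by omega), ← h3, mul_pow]; ring
  · obtain ⟨k, rfl⟩ := Nat.exists_eq_add_of_le' hm
    have h3 : x (k + s) * (θ ^ q ^ (k + s) - θ) = x k ^ q ^ s + b (k + s) := by
      rw [hxdef, recCoeff_add θ hs, div_mul_cancel₀ _ hne]
    rw [if_pos hm, Nat.add_sub_cancel, mul_pow, mul_pow, ← pow_mul, ← pow_add]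
    linear_combination z ^ q ^ (k + s) * h3

end Series

/-! ### The Carlitz exponential of rank `s` -/

section CarlitzExp

variable {Fq : Type*} [Field Fq] [Fintype Fq]
variable {K : Type*} [NormedField K] [Algebra Fq K]

local notation "q" => Fintype.card Fq

variable (Fq) in
/-- The coefficients of the exponential of `T e = θ e + τ ^ s e`. -/
def carlitzCoeff (θ : K) (s : ℕ) : ℕ → K := recCoeff Fq θ s 1 0

variable (Fq) in
/-- The exponential of `T e = θ e + τ ^ s e`. -/
def carlitzExp (θ : K) (s : ℕ) : K → K := frobSeries Fq (carlitzCoeff Fq θ s)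

variable [CompleteSpace K] [IsUltrametricDist K] {θ : K} {s : ℕ}

theorem norm_sub_le_max' (x y : K) : ‖x - y‖ ≤ max ‖x‖ ‖y‖ := by
  rw [sub_eq_add_neg, ← norm_neg y]
  exact IsUltrametricDist.norm_add_le_max _ _

theorem norm_carlitzCoeff_le (hθ : 1 < ‖θ‖) (hs : 0 < s) (m : ℕ) :
    ‖carlitzCoeff Fq θ s m‖ ≤ (‖θ‖⁻¹ ^ (m / s)) ^ q ^ m := by
  have := norm_recCoeff_le (Fq := Fq) hθ hs (x₀ := (1 : K)) (b := 0) le_rfl (by simp)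
    (fun m _ => by simp only [Pi.zero_apply, norm_zero]; positivity) m
  rwa [one_mul] at this

theorem isEntire_carlitzCoeff (hθ : 1 < ‖θ‖) (hs : 0 < s) :
    IsEntire Fq (carlitzCoeff Fq θ s) :=
  isEntire_of_norm_le hθ (Nat.tendsto_div_const_atTop hs.ne') (B := 1)
    fun m => by rw [one_mul]; exact norm_carlitzCoeff_le hθ hs m

theorem carlitzExp_zero : carlitzExp Fq θ s 0 = 0 := frobSeries_zero _

theorem carlitzExp_sub (hθ : 1 < ‖θ‖) (hs : 0 < s) (y z : K) :
    carlitzExp Fq θ s (y - z) = carlitzExp Fq θ s y - carlitzExp Fq θ s z :=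
  (isEntire_carlitzCoeff hθ hs).sub y z

theorem carlitzExp_mul (hθ : 1 < ‖θ‖) (hs : 0 < s) {c : K} (hc : c ^ q ^ s = c) (z : K) :
    carlitzExp Fq θ s (c * z) = c * carlitzExp Fq θ s z :=
  (isEntire_carlitzCoeff hθ hs).mul_of_dvd (recCoeff_eq_zero θ hs 1) hc z

theorem carlitzExp_theta_mul (hθ : 1 < ‖θ‖) (hs : 0 < s) (z : K) :
    carlitzExp Fq θ s (θ * z) = θ * carlitzExp Fq θ s z + carlitzExp Fq θ s z ^ q ^ s := by
  have := frobSeries_recCoeff_mul hθ hs (x₀ := (1 : K)) (b := 0) rfl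
    (isEntire_carlitzCoeff (Fq := Fq) hθ hs) (z := z) (β := 0) (by simp)
  simpa [carlitzExp, carlitzCoeff] using this

/-! ### The exponential on the ball of radius `‖ρ‖`, and its periods. -/

variable {ρ : K}

/-- The hypothesis says that ρ is a θ-torsion point: θρ + ρ^(q^s) = 0. -/
theorem norm_pow_of_pow_eq (hρ : ρ ^ q ^ s = -θ * ρ) : ‖ρ‖ ^ q ^ s = ‖θ‖ * ‖ρ‖ := by
  rw [← norm_pow, hρ, norm_mul, norm_neg]

theorem norm_carlitzCoeff_mul_le (hθ : 1 < ‖θ‖) (hs : 0 < s) (hρ : ρ ^ q ^ s = -θ * ρ) {m : ℕ}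
    (hm : m ≠ 0) : ‖carlitzCoeff Fq θ s m‖ * ‖ρ‖ ^ q ^ m ≤ ‖θ‖⁻¹ * ‖ρ‖ := by
  have hN : 0 < ‖θ‖ := by linarith
  -- The sharp bound fails at m = 0, so the induction also carries a weak one valid there. From the
  -- weak bound at k, the recursion gives at most ‖ρ‖^(q^s) / ‖θ‖^(q^(k+s)), where ‖ρ‖^(q^s) = ‖θ‖
  -- ‖ρ‖ and q^(k+s) ≥ 2.
  have key : ∀ m, ‖carlitzCoeff Fq θ s m‖ * ‖ρ‖ ^ q ^ m ≤ ‖ρ‖ ∧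
      (m ≠ 0 → ‖carlitzCoeff Fq θ s m‖ * ‖ρ‖ ^ q ^ m ≤ ‖θ‖⁻¹ * ‖ρ‖) := by
    intro m
    induction m using Nat.strong_induction_on with
    | _ m ih =>
      rcases eq_or_ne m 0 with rfl | h0
      · simp [carlitzCoeff, recCoeff_zero]
      suffices h : ‖carlitzCoeff Fq θ s m‖ * ‖ρ‖ ^ q ^ m ≤ ‖θ‖⁻¹ * ‖ρ‖ from
        ⟨h.trans (mul_le_of_le_one_left (norm_nonneg _) (inv_le_one_of_one_le₀ hθ.le)),
          fun _ => h⟩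
      rcases lt_or_ge m s with hlt | hge
      · rw [carlitzCoeff, recCoeff_of_lt θ 1 0 hlt h0]
        simp only [Pi.zero_apply, zero_div, norm_zero, zero_mul]
        positivity
      · obtain ⟨k, rfl⟩ := Nat.exists_eq_add_of_le' hge
        have h1 : carlitzCoeff Fq θ s (k + s) =
            carlitzCoeff Fq θ s k ^ q ^ s / (θ ^ q ^ (k + s) - θ) := by
          rw [carlitzCoeff, recCoeff_add θ hs]; simp
        rw [h1, norm_div, norm_pow_sub_self hθ h0, norm_pow, div_mul_eq_mul_div,
          div_le_iff₀ (by positivity)]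
        calc ‖carlitzCoeff Fq θ s k‖ ^ q ^ s * ‖ρ‖ ^ q ^ (k + s)
            = (‖carlitzCoeff Fq θ s k‖ * ‖ρ‖ ^ q ^ k) ^ q ^ s := by
              rw [mul_pow, ← pow_mul, ← pow_add]
          _ ≤ ‖ρ‖ ^ q ^ s := by
            have := (ih k (by omega)).1
            gcongr
          _ = ‖θ‖⁻¹ * ‖ρ‖ * ‖θ‖ ^ 2 := by
            rw [norm_pow_of_pow_eq hρ]; field_simp
          _ ≤ ‖θ‖⁻¹ * ‖ρ‖ * ‖θ‖ ^ q ^ (k + s) := by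
            gcongr
            · exact hθ.le
            · exact one_lt_card_pow Fq h0
  exact (key m).2 hm

/-- Passing from ρ to a smaller z multiplies the m-th term by (‖z‖ / ‖ρ‖)^(q^m) ≤ ‖z‖ / ‖ρ‖.
Isometry and surjectivity on the ball both follow from this bound. -/
theorem norm_carlitzExp_sub_le (hθ : 1 < ‖θ‖) (hs : 0 < s) (hρ0 : ρ ≠ 0)
    (hρ : ρ ^ q ^ s = -θ * ρ) {z : K} (hz : ‖z‖ ≤ ‖ρ‖) :
    ‖carlitzExp Fq θ s z - z‖ ≤ ‖θ‖⁻¹ * ‖z‖ := by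
  have hN : 0 < ‖θ‖ := by linarith
  have hρ' : 0 < ‖ρ‖ := norm_pos_iff.2 hρ0
  have := (isEntire_carlitzCoeff (Fq := Fq) hθ hs).norm_sub_le (z := z) (B := ‖θ‖⁻¹ * ‖z‖) ?_
  · have h0 : carlitzCoeff Fq θ s 0 = 1 := recCoeff_zero _ _ _ _
    rwa [h0, one_mul] at this
  intro m hm
  have h1 : ‖z‖ = ‖ρ‖ * (‖z‖ / ‖ρ‖) := by field_simp
  have h2 : ‖z‖ / ‖ρ‖ ≤ 1 := div_le_one_of_le₀ hz hρ'.le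
  calc ‖carlitzCoeff Fq θ s m * z ^ q ^ m‖
      = ‖carlitzCoeff Fq θ s m‖ * ‖ρ‖ ^ q ^ m * (‖z‖ / ‖ρ‖) ^ q ^ m := by
        rw [norm_mul, norm_pow, mul_assoc, ← mul_pow, ← h1]
    _ ≤ ‖θ‖⁻¹ * ‖ρ‖ * (‖z‖ / ‖ρ‖) := by
      refine mul_le_mul (norm_carlitzCoeff_mul_le hθ hs hρ hm) ?_ (by positivity) (by positivity)
      exact pow_le_of_le_one (by positivity) h2 (pow_ne_zero _ Fintype.card_ne_zero)
    _ = ‖θ‖⁻¹ * ‖z‖ := by rw [mul_assoc, ← h1]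

theorem norm_carlitzExp (hθ : 1 < ‖θ‖) (hs : 0 < s) (hρ0 : ρ ≠ 0)
    (hρ : ρ ^ q ^ s = -θ * ρ) {z : K} (hz : ‖z‖ ≤ ‖ρ‖) : ‖carlitzExp Fq θ s z‖ = ‖z‖ := by
  rcases eq_or_ne z 0 with rfl | h0
  · rw [carlitzExp_zero]
  have h1 : ‖carlitzExp Fq θ s z - z‖ < ‖z‖ :=
    (norm_carlitzExp_sub_le hθ hs hρ0 hρ hz).trans_lt
      (mul_lt_of_lt_one_left (norm_pos_iff.2 h0) (inv_lt_one_of_one_lt₀ hθ))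
  have h2 := IsUltrametricDist.norm_add_eq_max_of_norm_ne_norm h1.ne
  rwa [sub_add_cancel, max_eq_right h1.le] at h2

/-- The exponential maps the ball of radius `‖ρ‖` onto itself. -/
theorem exists_carlitzExp_eq (hθ : 1 < ‖θ‖) (hs : 0 < s) (hρ0 : ρ ≠ 0)
    (hρ : ρ ^ q ^ s = -θ * ρ) {y : K} (hy : ‖y‖ ≤ ‖ρ‖) :
    ∃ z, ‖z‖ = ‖y‖ ∧ carlitzExp Fq θ s z = y := by
  -- The fixed points of f are the solutions. By additivity f z - f w is the nonlinear part of the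
  -- exponential at w - z, so f contracts by ‖θ‖⁻¹.
  let f : K → K := fun z => y - (carlitzExp Fq θ s z - z)
  have hlt : ‖θ‖⁻¹ < 1 := inv_lt_one_of_one_lt₀ hθ
  have hmem : ∀ z : K, z ∈ Metric.closedBall (0 : K) ‖ρ‖ ↔ ‖z‖ ≤ ‖ρ‖ := fun z => by simp
  have hf : Set.MapsTo f (Metric.closedBall 0 ‖ρ‖) (Metric.closedBall 0 ‖ρ‖) := by
    intro z hz
    rw [hmem] at hz ⊢
    refine (norm_sub_le_max' _ _).trans (max_le hy ?_)
    exact (norm_carlitzExp_sub_le hθ hs hρ0 hρ hz).trans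
      ((mul_le_of_le_one_left (norm_nonneg _) hlt.le).trans hz)
  have hc : ContractingWith (‖θ‖₊⁻¹) (hf.restrict f _ _) := by
    refine ⟨by exact_mod_cast hlt, LipschitzWith.of_dist_le_mul ?_⟩
    rintro ⟨z, hz⟩ ⟨w, hw⟩
    rw [hmem] at hz hw
    have hzw : ‖w - z‖ ≤ ‖ρ‖ := (norm_sub_le_max' _ _).trans (max_le hw hz)
    change dist (f z) (f w) ≤ ‖θ‖⁻¹ * dist z w
    rw [dist_eq_norm, dist_comm z w, dist_eq_norm]
    have h : f z - f w = carlitzExp Fq θ s (w - z) - (w - z) := by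
      rw [carlitzExp_sub hθ hs]; simp only [f]; ring
    rw [h]
    exact norm_carlitzExp_sub_le hθ hs hρ0 hρ hzw
  obtain ⟨z, hz, hfz, -⟩ := hc.exists_fixedPoint' Metric.isClosed_closedBall.isComplete hf
    (x := 0) (by simp) (edist_ne_top _ _)
  rw [hmem] at hz
  have h : carlitzExp Fq θ s z = y := by
    have h1 : y - (carlitzExp Fq θ s z - z) = z := hfz
    linear_combination -h1
  exact ⟨z, by rw [← norm_carlitzExp hθ hs hρ0 hρ hz, h], h⟩

/-- The exponential of `T e = θ e + τ ^ s e` has a period `ϖ`, and each of its zeros is a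
polynomial in `θ` times `ϖ`, with coefficients in the field with `q ^ s` elements. -/
theorem exists_period (hθ : 1 < ‖θ‖) (hs : 0 < s) (hρ0 : ρ ≠ 0) (hρ : ρ ^ q ^ s = -θ * ρ) :
    ∃ ϖ : K, ϖ ≠ 0 ∧ carlitzExp Fq θ s ϖ = 0 ∧ ∀ S : Set K, (0 : K) ∈ S →
      (∀ l : K, l ^ q ^ s = l → ∀ c ∈ S, l + θ * c ∈ S) →
      ∀ z, carlitzExp Fq θ s z = 0 → ∃ c ∈ S, z = c * ϖ := by
  have hN : 0 < ‖θ‖ := by linarith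
  have hθ0 : θ ≠ 0 := norm_pos_iff.1 hN
  have hρ' : 0 < ‖ρ‖ := norm_pos_iff.2 hρ0
  -- η is a logarithm of the torsion point ρ, so θη is a period.
  obtain ⟨η, hη, hEη⟩ := exists_carlitzExp_eq hθ hs hρ0 hρ le_rfl
  have hη0 : η ≠ 0 := by rwa [← norm_pos_iff, hη]
  refine ⟨θ * η, mul_ne_zero hθ0 hη0, ?_, ?_⟩
  · rw [carlitzExp_theta_mul hθ hs, hEη, hρ]; ring
  -- S stands for the set of polynomials in θ, described by closure under Horner steps c ↦ l + θc.
  -- Descent on the size of z: e(z/θ) is θ-torsion, hence lρ with l^(q^s) = l, and z/θ - lη is a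
  -- zero with a bound smaller by ‖θ‖. In the ball of radius ‖ρ‖ the only zero is 0.
  intro S hS0 hS z hz
  obtain ⟨n, hn⟩ := pow_unbounded_of_one_lt (‖z‖ / ‖ρ‖) hθ
  have hn' : ‖z‖ ≤ ‖θ‖ ^ n * ‖ρ‖ := ((div_lt_iff₀ hρ').1 hn).le
  clear hn
  induction n generalizing z with
  | zero =>
    rw [pow_zero, one_mul] at hn'
    have h := norm_carlitzExp hθ hs hρ0 hρ hn'
    rw [hz, norm_zero] at h
    exact ⟨0, hS0, by rw [zero_mul]; exact norm_eq_zero.1 h.symm⟩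
  | succ n ih =>
    set w := carlitzExp Fq θ s (z / θ) with hw
    have h1 : w ^ q ^ s = -θ * w := by
      have := carlitzExp_theta_mul (Fq := Fq) hθ hs (z / θ)
      rw [mul_div_cancel₀ _ hθ0, hz, ← hw] at this
      linear_combination -this
    set l := w / ρ with hl
    have hlw : w = l * ρ := by rw [hl, div_mul_cancel₀ _ hρ0]
    have hl1 : l ^ q ^ s = l := by
      rw [hl, div_pow, h1, hρ, mul_div_mul_left _ _ (neg_ne_zero.2 hθ0)]
    have hl2 : ‖l‖ ≤ 1 := by
      by_contra! h
      have h3 := lt_self_pow₀ h (one_lt_card_pow Fq hs.ne')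
      rw [← norm_pow, hl1] at h3
      exact lt_irrefl _ h3
    have h4 : carlitzExp Fq θ s (z / θ - l * η) = 0 := by
      rw [carlitzExp_sub hθ hs, carlitzExp_mul hθ hs hl1, hEη, ← hw, hlw, sub_self]
    have h5 : ‖z / θ - l * η‖ ≤ ‖θ‖ ^ n * ‖ρ‖ := by
      refine (norm_sub_le_max' _ _).trans (max_le ?_ ?_)
      · rw [norm_div, div_le_iff₀ hN]
        exact hn'.trans_eq (by ring)
      · rw [norm_mul, hη]
        exact mul_le_mul (hl2.trans (one_le_pow₀ hθ.le)) le_rfl hρ'.le (by positivity)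
    obtain ⟨c, hc, hzc⟩ := ih (z / θ - l * η) h4 h5
    refine ⟨l + θ * c, hS l hl1 c hc, ?_⟩
    have h6 : θ * (z / θ) = z := by field_simp
    linear_combination θ * hzc - h6

end CarlitzExp

/-! ### Properties of `ℂ_∞` -/

section FieldFacts

variable {Fq : Type*} [Field Fq] [Fintype Fq]

local notation "q" => Fintype.card Fq

instance : IsUltrametricDist (Cinf Fq) := IsUltrametricDist.of_normedAlgebra (Rinf Fq)

variable (Fq) in
/-- The element `θ` of `ℝ_∞`. -/
def Rinf.theta : Rinf Fq := (HahnSeries.single (-1 : ℤ) (1 : Fq) : LaurentSeries Fq)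

theorem algebraMap_Rinf_theta : algebraMap (Rinf Fq) (Cinf Fq) (Rinf.theta Fq) = theta Fq := rfl

theorem one_lt_norm_theta : 1 < ‖theta Fq‖ := by
  rw [← algebraMap_Rinf_theta, norm_algebraMap']
  have h : (1 : WithZero (Multiplicative ℤ)) <
      Valued.v (HahnSeries.single (-1 : ℤ) (1 : Fq) : LaurentSeries Fq) := by
    rw [LaurentSeries.valuation_single_zpow]
    exact WithZero.exp_lt_exp.2 (by norm_num : (0 : ℤ) < -(-1))
  exact (Valued.toNormedField.one_lt_norm_iff (L := Rinf Fq)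
    (Γ₀ := WithZero (Multiplicative ℤ))).2 h

/-- The elements of the prime field of `q` elements inside any extension field. -/
theorem exists_algebraMap_eq {K : Type*} [Field K] [Algebra Fq K] {x : K} (hx : x ^ q = x) :
    ∃ c : Fq, algebraMap Fq K c = x := by
  classical
  have hne : (X ^ q - X : K[X]) ≠ 0 := FiniteField.X_pow_card_sub_X_ne_zero K Fintype.one_lt_card
  have hmem : ∀ y : K, y ∈ (X ^ q - X : K[X]).roots.toFinset ↔ y ^ q = y := fun y => by
    simp [hne, sub_eq_zero]
  have hsub : Finset.univ.image (algebraMap Fq K) ⊆ (X ^ q - X : K[X]).roots.toFinset := by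
    intro y hy
    obtain ⟨c, -, rfl⟩ := Finset.mem_image.1 hy
    rw [hmem, ← map_pow, FiniteField.pow_card]
  have hcard : (X ^ q - X : K[X]).roots.toFinset.card ≤
      (Finset.univ.image (algebraMap Fq K)).card := by
    rw [Finset.card_image_of_injective _ (algebraMap Fq K).injective, Finset.card_univ]
    refine (Multiset.toFinset_card_le _).trans ((Polynomial.card_roots' _).trans ?_)
    rw [FiniteField.X_pow_card_sub_X_natDegree_eq K Fintype.one_lt_card]
  have := Finset.eq_of_subset_of_card_le hsub hcard
  have hx' := (hmem x).2 hx
  rw [← this] at hx'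
  obtain ⟨c, -, hc⟩ := Finset.mem_image.1 hx'
  exact ⟨c, hc⟩

/-- The field with `q ^ 2` elements is `F_q + F_q ω`. -/
theorem exists_algebraMap_add_mul_eq {K : Type*} [NormedField K] [Algebra Fq K] {ω l : K}
    (hω : ω ^ q ^ 2 = ω) (hω' : ω ^ q ≠ ω) (hl : l ^ q ^ 2 = l) :
    ∃ a b : Fq, l = algebraMap Fq K a + algebraMap Fq K b * ω := by
  have hsub : ∀ x y : K, (x - y) ^ q = x ^ q - y ^ q := fun x y => by
    simpa using sub_pow_card_pow Fq 1 x y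
  have hne : ω - ω ^ q ≠ 0 := sub_ne_zero.2 hω'.symm
  rw [pow_two, pow_mul] at hω hl
  -- This is the coefficient b obtained by solving l = a + bω, l^q = a + bω^q.
  have hβ : ((l - l ^ q) / (ω - ω ^ q)) ^ q = (l - l ^ q) / (ω - ω ^ q) := by
    rw [div_pow, hsub, hsub, hω, hl, ← neg_sub l, ← neg_sub ω, neg_div_neg_eq]
  obtain ⟨b, hb⟩ := exists_algebraMap_eq hβ
  have hα : (l - algebraMap Fq K b * ω) ^ q = l - algebraMap Fq K b * ω := by
    rw [hsub, mul_pow, hb, hβ]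
    field_simp
    ring
  obtain ⟨a, ha⟩ := exists_algebraMap_eq hα
  exact ⟨a, b, by rw [ha]; ring⟩

/-- The only elements of `ℝ_∞` algebraic over `F_q` are the constants. -/
theorem Rinf.exists_algebraMap_eq {Q : ℕ} (hQ : 1 < Q) (hadd : ∀ x y : Rinf Fq,
    (x - y) ^ Q = x ^ Q - y ^ Q) (hFq : ∀ c : Fq, c ^ Q = c) {x : Rinf Fq} (hx : x ^ Q = x) :
    ∃ c : Fq, algebraMap Fq (Rinf Fq) c = x := by
  -- A solution of y^Q = y has valuation at most 1, and is 0 if the valuation is below 1. The latter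
  -- applies to x minus its constant coefficient.
  have hv : ∀ y : LaurentSeries Fq, y ^ Q = y →
      Valued.v y ≤ (1 : WithZero (Multiplicative ℤ)) := by
    intro y hy
    by_contra! h
    have h3 := lt_self_pow₀ h hQ
    rw [← map_pow, hy] at h3
    exact lt_irrefl _ h3
  have hv' : ∀ y : LaurentSeries Fq, y ^ Q = y →
      Valued.v y < (1 : WithZero (Multiplicative ℤ)) → y = 0 := by
    intro y hy h
    by_contra hy0
    have h1 : y ^ (Q - 1) = 1 := by
      apply mul_right_cancel₀ hy0
      rw [← pow_succ, Nat.sub_add_cancel hQ.le, hy, one_mul]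
    have h2 := pow_lt_one₀ zero_le h (n := Q - 1) (by omega)
    rw [← map_pow, h1, map_one] at h2
    exact lt_irrefl _ h2
  let y : LaurentSeries Fq := x
  refine ⟨y.coeff 0, ?_⟩
  have hc : ∀ c : Fq, (algebraMap Fq (LaurentSeries Fq) c) ^ Q = algebraMap Fq _ c := fun c => by
    rw [← map_pow, hFq]
  have hyx : y ^ Q = y := hx
  have h0 : (y - algebraMap Fq (LaurentSeries Fq) (y.coeff 0)) ^ Q =
      y - algebraMap Fq (LaurentSeries Fq) (y.coeff 0) := by
    have := hadd x (algebraMap Fq (LaurentSeries Fq) (y.coeff 0) : LaurentSeries Fq)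
    refine this.trans ?_
    exact congr_arg₂ _ hx (hc _)
  have h1 := hv y hyx
  rw [← WithZero.exp_zero, ← neg_zero, LaurentSeries.valuation_le_iff_coeff_lt_eq_zero] at h1
  have h2 : Valued.v (y - algebraMap Fq (LaurentSeries Fq) (y.coeff 0)) ≤
      WithZero.exp (-1 : ℤ) := by
    rw [LaurentSeries.valuation_le_iff_coeff_lt_eq_zero]
    intro n hn
    rw [HahnSeries.coeff_sub, LaurentSeries.algebraMap_apply, HahnSeries.C_apply]
    rcases eq_or_ne n 0 with rfl | hn0
    · simp
    · rw [h1 n (by omega), HahnSeries.coeff_single_of_ne hn0, sub_zero]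
  have h3 := hv' _ h0 (h2.trans_lt (by
    rw [← WithZero.exp_zero]; exact WithZero.exp_lt_exp.2 (by norm_num)))
  exact (sub_eq_zero.1 h3).symm

/-- An element of `F_{q ^ 2}` outside `F_q` is not in `ℝ_∞`. -/
theorem algebraMap_ne_of_pow {ω : Cinf Fq} (hω : ω ^ q ^ 2 = ω) (hω' : ω ^ q ≠ ω)
    (x : Rinf Fq) : algebraMap (Rinf Fq) (Cinf Fq) x ≠ ω := by
  rintro rfl
  have hx : x ^ q ^ 2 = x := by
    apply (algebraMap (Rinf Fq) (Cinf Fq)).injective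
    rw [map_pow, hω]
  obtain ⟨c, rfl⟩ := Rinf.exists_algebraMap_eq (one_lt_card_pow Fq two_ne_zero)
    (sub_pow_card_pow Fq 2) (fun c => FiniteField.pow_card_pow 2 c) hx
  apply hω'
  rw [← map_pow, ← map_pow, FiniteField.pow_card]

instance : IsAlgClosed (RinfAlg Fq) :=
  IsAlgClosure.isAlgClosed (Rinf Fq)

variable (Fq) in
/-- The inclusion of the algebraic closure of `ℝ_∞` in its completion. -/
def RinfAlg.toCinf : RinfAlg Fq →+* Cinf Fq :=
  (UniformSpace.Completion.coeRingHom : RinfAlg Fq →+* UniformSpace.Completion (RinfAlg Fq))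

theorem RinfAlg.toCinf_algebraMap (x : Rinf Fq) :
    RinfAlg.toCinf Fq (algebraMap (Rinf Fq) (RinfAlg Fq) x) = algebraMap (Rinf Fq) (Cinf Fq) x :=
  rfl

theorem RinfAlg.denseRange_toCinf : DenseRange (RinfAlg.toCinf Fq) :=
  UniformSpace.Completion.denseRange_coe

theorem exists_pow_eq_neg_theta_mul {s : ℕ} (hs : 0 < s) :
    ∃ ρ : Cinf Fq, ρ ≠ 0 ∧ ρ ^ q ^ s = -theta Fq * ρ := by
  have hQ := one_lt_card_pow Fq hs.ne'
  obtain ⟨r, hr⟩ := IsAlgClosed.exists_pow_nat_eq (n := q ^ s - 1)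
    (-algebraMap (Rinf Fq) (RinfAlg Fq) (Rinf.theta Fq)) (by omega)
  have hr' : RinfAlg.toCinf Fq r ^ (q ^ s - 1) = -theta Fq := by
    rw [← map_pow, hr, map_neg, RinfAlg.toCinf_algebraMap, algebraMap_Rinf_theta]
  refine ⟨RinfAlg.toCinf Fq r, ?_, ?_⟩
  · intro h
    rw [h, zero_pow (by omega)] at hr'
    have := one_lt_norm_theta (Fq := Fq)
    rw [← norm_neg, ← hr', norm_zero] at this
    linarith
  · rw [← hr', ← pow_succ, Nat.sub_add_cancel hQ.le]

/-- Choose η ≠ 0 with η^q = -η, then ω with ω^q = ω + η; a second Frobenius cancels η. An ω is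
needed even for the assertions that do not mention it. -/
theorem exists_pow_card_sq_eq : ∃ ω : Cinf Fq, ω ^ q ^ 2 = ω ∧ ω ^ q ≠ ω := by
  have hq : 1 < q := Fintype.one_lt_card
  obtain ⟨y, hy⟩ := IsAlgClosed.exists_pow_nat_eq (n := q - 1) (-1 : RinfAlg Fq) (by omega)
  have hdeg : (X ^ q - X - Polynomial.C y : (RinfAlg Fq)[X]).degree ≠ 0 := by
    have h1 : (X ^ q - X : (RinfAlg Fq)[X]).natDegree = q :=
      FiniteField.X_pow_card_sub_X_natDegree_eq _ hq
    intro h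
    have h2 : (X ^ q - X - Polynomial.C y : (RinfAlg Fq)[X]).natDegree = 0 :=
      Polynomial.natDegree_eq_of_degree_eq_some h
    rw [Polynomial.natDegree_sub_C, h1] at h2
    omega
  obtain ⟨w, hw⟩ := IsAlgClosed.exists_root _ hdeg
  simp only [IsRoot.def, eval_sub, eval_pow, eval_X, eval_C] at hw
  set ω := RinfAlg.toCinf Fq w
  set η := RinfAlg.toCinf Fq y
  have hη : η ^ q = -η := by
    have h1 : η ^ (q - 1) = -1 := by rw [← map_pow, hy, map_neg, map_one]
    have h2 : η ^ q = η ^ (q - 1) * η := by rw [← pow_succ, Nat.sub_add_cancel hq.le]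
    rw [h2, h1, neg_one_mul]
  have hη0 : η ≠ 0 := by
    rintro h
    have h1 : η ^ (q - 1) = -1 := by rw [← map_pow, hy, map_neg, map_one]
    rw [h, zero_pow (by omega)] at h1
    exact neg_ne_zero.2 one_ne_zero h1.symm
  have hω : ω ^ q = ω + η := by
    have h1 : w ^ q = w + y := by linear_combination hw
    rw [← map_pow, h1, map_add]
  refine ⟨ω, ?_, ?_⟩
  · have := add_pow_card_pow Fq 1 ω η
    rw [pow_one] at this
    rw [pow_two, pow_mul, hω, this, hω, hη]
    ring
  · rw [hω]
    simpa using hη0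

/-- `ℂ_∞` is perfect. -/
theorem exists_pow_card_eq (x : Cinf Fq) : ∃ y : Cinf Fq, y ^ q = x := by
  have hq0 : q ≠ 0 := Fintype.card_ne_zero
  have hsub : ∀ x y : Cinf Fq, (x - y) ^ q = x ^ q - y ^ q := fun x y => by
    simpa using sub_pow_card_pow Fq 1 x y
  choose r hr using fun z : RinfAlg Fq =>
    IsAlgClosed.exists_pow_nat_eq z (Nat.pos_of_ne_zero hq0)
  obtain ⟨u, hu⟩ := mem_closure_iff_seq_limit.1 (RinfAlg.denseRange_toCinf x)
  obtain ⟨hu1, hu2⟩ := hu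
  choose v hv using hu1
  let w : ℕ → Cinf Fq := fun n => RinfAlg.toCinf Fq (r (v n))
  have hw : ∀ n, w n ^ q = u n := fun n => by rw [← map_pow, hr, hv]
  -- Since ‖x - y‖^q = ‖x^q - y^q‖, the q-th roots of a Cauchy sequence form a Cauchy sequence.
  have hcauchy : CauchySeq w := by
    rw [Metric.cauchySeq_iff]
    intro ε hε
    obtain ⟨n, hn⟩ := Metric.cauchySeq_iff.1 hu2.cauchySeq (ε ^ q) (by positivity)
    refine ⟨n, fun k hk l hl => ?_⟩
    have h := hn k hk l hl
    rw [dist_eq_norm, ← hw, ← hw, ← hsub, norm_pow] at h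
    rw [dist_eq_norm]
    exact lt_of_pow_lt_pow_left₀ q hε.le h
  obtain ⟨y, hy⟩ := cauchySeq_tendsto_of_complete hcauchy
  refine ⟨y, tendsto_nhds_unique ?_ hu2⟩
  have := hy.pow q
  simpa only [hw] using this

end FieldFacts

/-! ### Uniqueness of the exponential -/

section Exponential

variable {Fq : Type*} [Field Fq] [Fintype Fq]

local notation "q" => Fintype.card Fq

variable {M : Type*} [AddCommGroup M] [Module (Twisted Fq) M] [Module (AndersonRing Fq) M]
  {ι : Type*} [Fintype ι] [DecidableEq ι]

theorem twistedEval_sub (f : Twisted Fq) (y z : Cinf Fq) :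
    twistedEval f (y - z) = twistedEval f y - twistedEval f z := by
  simp only [twistedEval, SkewPolynomial.sum_def, ← Finset.sum_sub_distrib,
    sub_pow_card_pow Fq, mul_sub]

theorem actT_sub (e : Module.Basis ι (Twisted Fq) M) (Y Z : ι → Cinf Fq) :
    actT e (Y - Z) = actT e Y - actT e Z := by
  funext j
  simp only [actT, Pi.sub_apply, twistedEval_sub, Finset.sum_sub_distrib]

theorem actT_zero (e : Module.Basis ι (Twisted Fq) M) : actT e 0 = 0 := by
  simpa using actT_sub e 0 0

theorem norm_frobVec_le (m : ℕ) (Z : ι → Cinf Fq) : ‖frobVec m Z‖ ≤ ‖Z‖ ^ q ^ m := by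
  refine (pi_norm_le_iff_of_nonneg (by positivity)).2 fun i => ?_
  rw [frobVec, norm_pow]
  gcongr
  exact norm_le_pi_norm Z i

theorem norm_mulVec_le {A : Matrix ι ι (Cinf Fq)} {B : ℝ} (hB : 0 ≤ B) (hA : ∀ i j, ‖A i j‖ ≤ B)
    (v : ι → Cinf Fq) : ‖A.mulVec v‖ ≤ B * ‖v‖ := by
  refine (pi_norm_le_iff_of_nonneg (by positivity)).2 fun i => ?_
  refine IsUltrametricDist.norm_sum_le_of_forall_le_of_nonneg (by positivity) fun j _ => ?_
  rw [norm_mul]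
  exact mul_le_mul (hA i j) (norm_le_pi_norm v j) (norm_nonneg _) hB

/-- Frobenius fixes the unit vectors, so at them the terms of the series are the columns of `C m`;
these tend to 0. -/
theorem exists_norm_apply_le_of_hasSum {C : ℕ → Matrix ι ι (Cinf Fq)}
    (hC : ∀ Z, ∃ E, HasSum (fun m => (C m).mulVec (frobVec m Z)) E) :
    ∃ B : ℝ, 0 ≤ B ∧ ∀ m i j, ‖C m i j‖ ≤ B := by
  have h : ∀ j, ∃ B : ℝ, ∀ m i, ‖C m i j‖ ≤ B := by
    intro j
    obtain ⟨E, hE⟩ := hC (Pi.single j 1)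
    obtain ⟨B, hB⟩ := hE.summable.tendsto_atTop_zero.norm.bddAbove_range
    refine ⟨B, fun m i => ?_⟩
    have h1 : frobVec m (Pi.single j (1 : Cinf Fq)) = Pi.single j 1 := by
      funext k
      rcases eq_or_ne k j with rfl | hk
      · simp [frobVec]
      · simp [frobVec, hk, zero_pow (pow_ne_zero _ Fintype.card_ne_zero)]
    have h2 := hB (Set.mem_range_self m)
    simp only [h1, Matrix.mulVec_single_one] at h2
    exact (norm_le_pi_norm _ i).trans h2
  choose B hB using h
  refine ⟨∑ j, |B j|, Finset.sum_nonneg fun j _ => abs_nonneg _, fun m i j => ?_⟩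
  exact (hB j m i).trans ((le_abs_self _).trans
    (Finset.single_le_sum (f := fun j => |B j|) (fun j _ => abs_nonneg _) (Finset.mem_univ j)))

/-- Two exponentials agree to the first order at the origin. -/
theorem IsExp.exists_norm_sub_le {e : Module.Basis ι (Twisted Fq) M}
    {E E' : (ι → Cinf Fq) → (ι → Cinf Fq)} (hE : IsExp e E) (hE' : IsExp e E') :
    ∃ B : ℝ, ∀ Z, ‖Z‖ ≤ 1 → ‖E Z - E' Z‖ ≤ B * ‖Z‖ ^ 2 := by
  obtain ⟨⟨C, hC0, hC⟩, -⟩ := hE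
  obtain ⟨⟨C', hC0', hC'⟩, -⟩ := hE'
  have hD : ∀ Z, HasSum (fun m => (C m - C' m).mulVec (frobVec m Z)) (E Z - E' Z) := fun Z => by
    simp only [Matrix.sub_mulVec]
    exact (hC Z).sub (hC' Z)
  obtain ⟨B, hB0, hB⟩ := exists_norm_apply_le_of_hasSum fun Z => ⟨_, hD Z⟩
  refine ⟨B, fun Z hZ => ?_⟩
  rw [← (hD Z).tsum_eq]
  refine IsUltrametricDist.norm_tsum_le_of_forall_le fun m => ?_
  rcases eq_or_ne m 0 with rfl | hm
  · rw [hC0, hC0', sub_self, Matrix.zero_mulVec, norm_zero]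
    positivity
  · refine (norm_mulVec_le hB0 (hB m) _).trans ?_
    gcongr
    exact (norm_frobVec_le m Z).trans
      (pow_le_pow_of_le_one (norm_nonneg _) hZ (one_lt_card_pow Fq hm))

/-- The exponential is unique if `T` expands small vectors by the factor `|θ|` at most. -/
theorem IsExp.unique {e : Module.Basis ι (Twisted Fq) M} {δ : ℝ} (hδ : 0 < δ)
    (hT : ∀ W, ‖W‖ ≤ δ → ‖actT e W‖ ≤ ‖theta Fq‖ * ‖W‖)
    {E E' : (ι → Cinf Fq) → (ι → Cinf Fq)} (hE : IsExp e E) (hE' : IsExp e E') : E = E' := by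
  obtain ⟨B, hB⟩ := hE.exists_norm_sub_le hE'
  have hN := one_lt_norm_theta (Fq := Fq)
  have hN0 : 0 < ‖theta Fq‖ := by linarith
  have hθ0 : theta Fq ≠ 0 := norm_pos_iff.1 hN0
  funext Z
  -- The difference at θ^(-n) Z is O(|θ|^(-2n)), while T carries `w (n + 1)` to `w n` and expands by
  -- |θ| at most. Going k steps back from n₀ + k bounds `w n₀` by O(|θ|^(-k)), so it is 0, and
  -- applying T repeatedly gives `w 0 = 0`.
  let w : ℕ → ι → Cinf Fq := fun n => E ((theta Fq)⁻¹ ^ n • Z) - E' ((theta Fq)⁻¹ ^ n • Z)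
  have hw : ∀ n, w n = actT e (w (n + 1)) := by
    intro n
    have h1 : (theta Fq)⁻¹ ^ n • Z = theta Fq • ((theta Fq)⁻¹ ^ (n + 1) • Z) := by
      rw [smul_smul, pow_succ', ← mul_assoc, mul_inv_cancel₀ hθ0, one_mul]
    simp only [w]
    rw [actT_sub, ← hE.2, ← hE'.2, ← h1]
  have hlim : Filter.Tendsto (fun n : ℕ => ‖theta Fq‖⁻¹ ^ n) Filter.atTop (𝓝 0) :=
    tendsto_pow_atTop_nhds_zero_of_lt_one (by positivity) (inv_lt_one_of_one_lt₀ hN)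
  have hZn : ∀ n, ‖(theta Fq)⁻¹ ^ n • Z‖ = ‖theta Fq‖⁻¹ ^ n * ‖Z‖ := fun n => by
    rw [norm_smul, norm_pow, norm_inv]
  have hsmall : ∀ᶠ n in Filter.atTop, ‖w n‖ ≤ B * ‖Z‖ ^ 2 * (‖theta Fq‖⁻¹ ^ n) ^ 2 := by
    have h1 : Filter.Tendsto (fun n : ℕ => ‖theta Fq‖⁻¹ ^ n * ‖Z‖) Filter.atTop (𝓝 0) := by
      simpa using hlim.mul_const ‖Z‖
    filter_upwards [h1.eventually_lt_const zero_lt_one] with n hn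
    have h2 := hB ((theta Fq)⁻¹ ^ n • Z) (by rw [hZn]; exact hn.le)
    rw [hZn] at h2
    exact h2.trans_eq (by ring)
  have hδ' : ∀ᶠ n in Filter.atTop, B * ‖Z‖ ^ 2 * (‖theta Fq‖⁻¹ ^ n) ^ 2 < δ := by
    have h1 : Filter.Tendsto (fun n : ℕ => B * ‖Z‖ ^ 2 * (‖theta Fq‖⁻¹ ^ n) ^ 2)
        Filter.atTop (𝓝 0) := by simpa using (hlim.pow 2).const_mul (B * ‖Z‖ ^ 2)
    exact h1.eventually_lt_const hδ
  obtain ⟨n₀, hn₀⟩ := Filter.eventually_atTop.1 (hsmall.and hδ')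
  have hstep : ∀ k, ‖w n₀‖ ≤ ‖theta Fq‖ ^ k * ‖w (n₀ + k)‖ := by
    intro k
    induction k with
    | zero => simp
    | succ k ih =>
      refine ih.trans ?_
      have h1 := hn₀ (n₀ + k + 1) (by omega)
      have h2 := hT _ (h1.1.trans h1.2.le)
      rw [← hw] at h2
      calc ‖theta Fq‖ ^ k * ‖w (n₀ + k)‖
          ≤ ‖theta Fq‖ ^ k * (‖theta Fq‖ * ‖w (n₀ + k + 1)‖) := by gcongr
        _ = ‖theta Fq‖ ^ (k + 1) * ‖w (n₀ + (k + 1))‖ := by rw [pow_succ]; ring_nf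
  have hzero : ‖w n₀‖ ≤ 0 := by
    have h1 : Filter.Tendsto
        (fun k : ℕ => B * ‖Z‖ ^ 2 * (‖theta Fq‖⁻¹ ^ n₀) ^ 2 * ‖theta Fq‖⁻¹ ^ k)
        Filter.atTop (𝓝 0) := by
      have h2 := hlim.const_mul (B * ‖Z‖ ^ 2 * (‖theta Fq‖⁻¹ ^ n₀) ^ 2)
      rwa [mul_zero] at h2
    refine ge_of_tendsto' h1 fun k => ?_
    calc ‖w n₀‖ ≤ ‖theta Fq‖ ^ k * ‖w (n₀ + k)‖ := hstep k
      _ ≤ ‖theta Fq‖ ^ k * (B * ‖Z‖ ^ 2 * (‖theta Fq‖⁻¹ ^ (n₀ + k)) ^ 2) := by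
        gcongr
        exact (hn₀ (n₀ + k) (by omega)).1
      _ = B * ‖Z‖ ^ 2 * (‖theta Fq‖⁻¹ ^ n₀) ^ 2 * ‖theta Fq‖⁻¹ ^ k := by
        have h2 : ‖theta Fq‖ ^ k * ‖theta Fq‖⁻¹ ^ k = 1 := by
          rw [← mul_pow, mul_inv_cancel₀ hN0.ne', one_pow]
        rw [pow_add]
        linear_combination B * ‖Z‖ ^ 2 * (‖theta Fq‖⁻¹ ^ n₀) ^ 2 * ‖theta Fq‖⁻¹ ^ k * h2
  have hall : ∀ n, w n = 0 → w 0 = 0 := by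
    intro n
    induction n with
    | zero => exact id
    | succ n ih => exact fun h => ih (by rw [hw, h, actT_zero])
  have h0 := hall n₀ (norm_le_zero_iff.1 hzero)
  simp only [w, pow_zero, one_smul] at h0
  exact sub_eq_zero.1 h0

theorem expMap_eq {e : Module.Basis ι (Twisted Fq) M} {δ : ℝ} (hδ : 0 < δ)
    (hT : ∀ W, ‖W‖ ≤ δ → ‖actT e W‖ ≤ ‖theta Fq‖ * ‖W‖)
    {E : (ι → Cinf Fq) → (ι → Cinf Fq)} (hE : IsExp e E) : expMap e = E := by
  have h : ∃ E, IsExp e E := ⟨E, hE⟩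
  rw [expMap, dif_pos h]
  exact IsExp.unique hδ hT h.choose_spec hE

/-! ### The exponential of an extension of the Carlitz module of rank 2 by the Carlitz module -/

/-- The basis `e` consists of two elements `e i₁`, `e i₂` with
`T e i₁ = θ e i₁ + a τ e i₂ + τ ^ 2 e i₁` and `T e i₂ = θ e i₂ + τ e i₂`, as seen by the
action of `T` on vectors. -/
structure IsExtensionBasis (e : Module.Basis ι (Twisted Fq) M) (i₁ i₂ : ι) (a : Cinf Fq) :
    Prop where
  ne : i₁ ≠ i₂
  eq_or (i : ι) : i = i₁ ∨ i = i₂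
  actT_fst (Z : ι → Cinf Fq) :
    actT e Z i₁ = theta Fq * Z i₁ + Z i₁ ^ q ^ 2 + a * Z i₂ ^ q
  actT_snd (Z : ι → Cinf Fq) : actT e Z i₂ = theta Fq * Z i₂ + Z i₂ ^ q

variable {e : Module.Basis ι (Twisted Fq) M} {i₁ i₂ : ι} {a : Cinf Fq}

theorem IsExtensionBasis.norm_actT_le (h : IsExtensionBasis e i₁ i₂ a) :
    ∃ δ : ℝ, 0 < δ ∧ ∀ W, ‖W‖ ≤ δ → ‖actT e W‖ ≤ ‖theta Fq‖ * ‖W‖ := by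
  have hN := one_lt_norm_theta (Fq := Fq)
  have hq : 2 ≤ q := Fintype.one_lt_card
  -- This radius gives both ‖W‖ ≤ 1 and ‖a‖ ‖W‖ ≤ 1, so every nonlinear term is at most ‖W‖.
  refine ⟨(1 + ‖a‖)⁻¹, by positivity, fun W hW => ?_⟩
  have hW1 : ‖W‖ ≤ 1 := hW.trans (inv_le_one_of_one_le₀ (by linarith [norm_nonneg a]))
  have hpow : ∀ (x : Cinf Fq) (k : ℕ), ‖x‖ ≤ ‖W‖ → k ≠ 0 → ‖x ^ k‖ ≤ ‖theta Fq‖ * ‖W‖ := by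
    intro x k hx hk
    rw [norm_pow]
    calc ‖x‖ ^ k ≤ ‖x‖ := pow_le_of_le_one (norm_nonneg _) (hx.trans hW1) hk
      _ ≤ 1 * ‖W‖ := by rwa [one_mul]
      _ ≤ ‖theta Fq‖ * ‖W‖ := by gcongr
  have hlin : ∀ i, ‖theta Fq * W i‖ ≤ ‖theta Fq‖ * ‖W‖ := fun i => by
    rw [norm_mul]
    gcongr
    exact norm_le_pi_norm W i
  have ha : ‖a * W i₂ ^ q‖ ≤ ‖theta Fq‖ * ‖W‖ := by
    rw [norm_mul, norm_pow]
    have h1 : ‖a‖ * ‖W‖ ≤ 1 := by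
      calc ‖a‖ * ‖W‖ ≤ (1 + ‖a‖) * (1 + ‖a‖)⁻¹ := by
            gcongr
            linarith
        _ = 1 := mul_inv_cancel₀ (by positivity)
    calc ‖a‖ * ‖W i₂‖ ^ q ≤ ‖a‖ * ‖W‖ ^ q := by gcongr; exact norm_le_pi_norm W i₂
      _ ≤ ‖a‖ * ‖W‖ ^ 2 := by
        gcongr 1
        exact pow_le_pow_of_le_one (norm_nonneg _) hW1 hq
      _ = ‖a‖ * ‖W‖ * ‖W‖ := by ring
      _ ≤ 1 * ‖W‖ := by gcongr
      _ ≤ ‖theta Fq‖ * ‖W‖ := by gcongr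
  refine (pi_norm_le_iff_of_nonneg (by positivity)).2 fun i => ?_
  rcases h.eq_or i with rfl | rfl
  · rw [h.actT_fst]
    refine (IsUltrametricDist.norm_add_le_max _ _).trans (max_le ?_ ha)
    exact (IsUltrametricDist.norm_add_le_max _ _).trans
      (max_le (hlin _) (hpow _ _ (norm_le_pi_norm W _) (pow_ne_zero _ (by omega))))
  · rw [h.actT_snd]
    exact (IsUltrametricDist.norm_add_le_max _ _).trans
      (max_le (hlin _) (hpow _ _ (norm_le_pi_norm W _) (by omega)))

/-- The coefficients of the off-diagonal part of the exponential of `M(a)`. -/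
def extCoeff (a : Cinf Fq) : ℕ → Cinf Fq :=
  recCoeff Fq (theta Fq) 2 0
    fun m => if m = 0 then 0 else a * carlitzCoeff Fq (theta Fq) 1 (m - 1) ^ q

/-- The off-diagonal part of the exponential of `M(a)`. -/
def extExp (a : Cinf Fq) : Cinf Fq → Cinf Fq := frobSeries Fq (extCoeff a)

/-- The forcing term comes from a rank 1 exponential, whose coefficients decay faster than the rank
2 recursion requires, so `norm_recCoeff_le` applies with B = ‖a‖. The factor ‖a‖ is what later makes
the off-diagonal part small. -/
theorem norm_extCoeff_le (ha : ‖a‖ ≤ 1) (m : ℕ) :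
    ‖extCoeff a m‖ ≤ ‖a‖ * (‖theta Fq‖⁻¹ ^ (m / 2)) ^ q ^ m := by
  have hN := one_lt_norm_theta (Fq := Fq)
  have hN0 : 0 < ‖theta Fq‖ := by linarith
  refine norm_recCoeff_le hN two_pos ha (by simp) (fun m hm => ?_) m
  obtain ⟨k, rfl⟩ := Nat.exists_eq_succ_of_ne_zero hm
  rw [if_neg hm, norm_mul, norm_pow, mul_assoc, Nat.succ_sub_one]
  gcongr
  calc ‖carlitzCoeff Fq (theta Fq) 1 k‖ ^ q
      ≤ ((‖theta Fq‖⁻¹ ^ (k / 1)) ^ q ^ k) ^ q := by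
        gcongr
        exact norm_carlitzCoeff_le hN one_pos k
    _ = (‖theta Fq‖⁻¹ ^ (k + 1) * ‖theta Fq‖) ^ q ^ (k + 1) := by
      rw [← pow_mul, ← pow_succ, Nat.div_one, pow_succ ‖theta Fq‖⁻¹, mul_assoc,
        inv_mul_cancel₀ hN0.ne', mul_one]
    _ ≤ (‖theta Fq‖⁻¹ ^ ((k + 1) / 2) * ‖theta Fq‖) ^ q ^ (k + 1) := by
      gcongr ?_ ^ _
      refine mul_le_mul_of_nonneg_right ?_ hN0.le
      exact pow_le_pow_of_le_one (by positivity) (inv_le_one_of_one_le₀ hN.le) (by omega)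
    _ = _ := mul_pow _ _ _

theorem isEntire_extCoeff (ha : ‖a‖ ≤ 1) : IsEntire Fq (extCoeff a) :=
  isEntire_of_norm_le one_lt_norm_theta (Nat.tendsto_div_const_atTop two_ne_zero)
    (norm_extCoeff_le ha)

theorem extExp_theta_mul (ha : ‖a‖ ≤ 1) (z : Cinf Fq) :
    extExp a (theta Fq * z) = theta Fq * extExp a z + extExp a z ^ q ^ 2 +
      a * carlitzExp Fq (theta Fq) 1 z ^ q := by
  have hN := one_lt_norm_theta (Fq := Fq)
  refine frobSeries_recCoeff_mul hN two_pos (if_pos rfl) (isEntire_extCoeff ha) ?_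
  have h1 := (((isEntire_carlitzCoeff (Fq := Fq) hN one_pos).hasSum z).map
    (powHom Fq (Cinf Fq) 1) (continuous_pow _)).mul_left a
  -- The q-th power of the Carlitz series starts at index 1; the forcing term at 0 is zero, so
  -- dropping it changes nothing.
  rw [← hasSum_nat_add_iff' 1]
  simp only [Finset.sum_range_one, if_true, zero_mul, sub_zero]
  have h2 : carlitzExp Fq (theta Fq) 1 z ^ q =
      powHom Fq (Cinf Fq) 1 (frobSeries Fq (carlitzCoeff Fq (theta Fq) 1) z) := by
    rw [powHom_apply, pow_one]; rfl
  rw [h2]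
  refine h1.congr_fun fun m => ?_
  simp only [Function.comp, powHom_apply, pow_one]
  rw [if_neg (by omega), Nat.add_sub_cancel, mul_pow, ← pow_mul, ← pow_succ, mul_assoc]

variable (i₁ i₂ a) in
/-- The exponential of an extension of the Carlitz module of rank 2 by the Carlitz module. -/
def extensionExp (Z : ι → Cinf Fq) (i : ι) : Cinf Fq :=
  if i = i₁ then carlitzExp Fq (theta Fq) 2 (Z i₁) + extExp a (Z i₂)
  else carlitzExp Fq (theta Fq) 1 (Z i₂)

theorem IsExtensionBasis.isExp (h : IsExtensionBasis e i₁ i₂ a) (ha : ‖a‖ ≤ 1) :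
    IsExp e (extensionExp i₁ i₂ a) := by
  have hN := one_lt_norm_theta (Fq := Fq)
  have h21 : i₂ ≠ i₁ := h.ne.symm
  constructor
  · refine ⟨fun m => Matrix.of fun i j =>
      if i = i₁ then (if j = i₁ then carlitzCoeff Fq (theta Fq) 2 m else extCoeff a m)
      else (if j = i₁ then 0 else carlitzCoeff Fq (theta Fq) 1 m), ?_, fun Z => ?_⟩
    · ext i j
      rcases h.eq_or i with rfl | rfl <;> rcases h.eq_or j with rfl | rfl <;>
        simp [carlitzCoeff, extCoeff, recCoeff_zero, h.ne, h21]
    · rw [Pi.hasSum]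
      intro i
      have hsum : ∀ f : ι → Cinf Fq, ∑ j, f j = f i₁ + f i₂ := fun f =>
        Fintype.sum_eq_add i₁ i₂ h.ne fun j hj => (h.eq_or j).elim (absurd · hj.1) (absurd · hj.2)
      simp only [Matrix.mulVec, dotProduct, hsum, Matrix.of_apply, if_true, if_neg h21, frobVec]
      rcases h.eq_or i with rfl | rfl
      · simp only [extensionExp, if_true]
        exact ((isEntire_carlitzCoeff hN two_pos).hasSum _).add ((isEntire_extCoeff ha).hasSum _)
      · simp only [extensionExp, if_neg h21, zero_mul, zero_add]
        exact (isEntire_carlitzCoeff hN one_pos).hasSum _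
  · intro Z
    funext i
    rcases h.eq_or i with rfl | rfl
    · rw [h.actT_fst]
      simp only [extensionExp, if_true, if_neg h21, Pi.smul_apply, smul_eq_mul,
        carlitzExp_theta_mul hN two_pos, extExp_theta_mul ha, add_pow_card_pow Fq]
      ring
    · rw [h.actT_snd]
      simp only [extensionExp, if_neg h21, Pi.smul_apply, smul_eq_mul,
        carlitzExp_theta_mul hN one_pos, pow_one]

theorem IsExtensionBasis.mem_lattice (h : IsExtensionBasis e i₁ i₂ a) (ha : ‖a‖ ≤ 1)
    (Z : ι → Cinf Fq) : Z ∈ lattice e ↔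
      carlitzExp Fq (theta Fq) 2 (Z i₁) + extExp a (Z i₂) = 0 ∧
        carlitzExp Fq (theta Fq) 1 (Z i₂) = 0 := by
  obtain ⟨δ, hδ, hT⟩ := h.norm_actT_le
  change expMap e Z = 0 ↔ _
  rw [expMap_eq hδ hT (h.isExp ha), funext_iff]
  constructor
  · intro h0
    have h1 := h0 i₁
    have h2 := h0 i₂
    simp only [extensionExp, if_true, if_neg h.ne.symm] at h1 h2
    exact ⟨h1, h2⟩
  · rintro ⟨h1, h2⟩ i
    rcases h.eq_or i with rfl | rfl
    · simpa only [extensionExp, if_true, Pi.zero_apply] using h1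
    · simpa only [extensionExp, if_neg h.ne.symm, Pi.zero_apply] using h2

/-- For small `a` the off-diagonal part of the exponential is small. -/
theorem exists_norm_extExp_le (z : Cinf Fq) :
    ∃ B : ℝ, 0 < B ∧ ∀ a : Cinf Fq, ‖a‖ ≤ 1 → ‖extExp a z‖ ≤ ‖a‖ * B := by
  have hN := one_lt_norm_theta (Fq := Fq)
  -- A majorant that does not depend on a.
  have hlim : IsEntire Fq fun m => ((theta Fq)⁻¹ ^ (m / 2)) ^ q ^ m :=
    isEntire_of_norm_le hN (Nat.tendsto_div_const_atTop two_ne_zero) (B := 1) fun m => by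
      rw [norm_pow, norm_pow, norm_inv, one_mul]
  obtain ⟨B, hB⟩ := (hlim z).norm.bddAbove_range
  refine ⟨max B 1, by positivity, fun a ha => ?_⟩
  refine norm_frobSeries_le fun m => ?_
  have h1 := hB (Set.mem_range_self m)
  simp only [norm_mul, norm_pow, norm_inv] at h1
  rw [norm_mul, norm_pow]
  calc ‖extCoeff a m‖ * ‖z‖ ^ q ^ m
      ≤ ‖a‖ * (‖theta Fq‖⁻¹ ^ (m / 2)) ^ q ^ m * ‖z‖ ^ q ^ m := by
        gcongr
        exact norm_extCoeff_le ha m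
    _ = ‖a‖ * ((‖theta Fq‖⁻¹ ^ (m / 2)) ^ q ^ m * ‖z‖ ^ q ^ m) := mul_assoc _ _ _
    _ ≤ ‖a‖ * max B 1 := by
      gcongr
      exact h1.trans (le_max_left _ _)

end Exponential

/-! ### Lattices with a Siegel matrix `(0, ω)` -/

section Frames

variable {Fq : Type*} [Field Fq] [Fintype Fq]

local notation "q" => Fintype.card Fq

variable {ι κ : Type*} [Fintype ι] [Fintype κ]

/-- The vectors `v₀, v₁, ω v₁`. -/
def frame (v : Module.Basis (Fin 2) (Cinf Fq) (ι → Cinf Fq)) (ω : Cinf Fq) :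
    Fin 3 → ι → Cinf Fq :=
  ![v 0, v 1, ω • v 1]

/-- `L` is generated over `F_q[θ]` by `v₀, v₁, ω v₁`. -/
def IsFramed (L : Submodule (FqTheta Fq) (ι → Cinf Fq)) (ω : Cinf Fq)
    (v : Module.Basis (Fin 2) (Cinf Fq) (ι → Cinf Fq)) : Prop :=
  ∀ Z, Z ∈ L ↔ ∃ c : Fin 3 → FqTheta Fq, Z = ∑ k, c k • frame v ω k

/-- This makes independence over F_q[θ] a consequence of independence over ℝ_∞. -/
theorem exists_algebraMap_eq_of_mem_FqTheta {c : Cinf Fq} (hc : c ∈ FqTheta Fq) :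
    ∃ r : Rinf Fq, algebraMap (Rinf Fq) (Cinf Fq) r = c := by
  induction hc using Algebra.adjoin_induction with
  | mem x hx => exact ⟨Rinf.theta Fq, (Set.mem_singleton_iff.1 hx).symm⟩
  | algebraMap r => exact ⟨algebraMap Fq (Rinf Fq) r, rfl⟩
  | add x y _ _ hx hy =>
    obtain ⟨r, rfl⟩ := hx
    obtain ⟨s, rfl⟩ := hy
    exact ⟨r + s, map_add _ _ _⟩
  | mul x y _ _ hx hy =>
    obtain ⟨r, rfl⟩ := hx
    obtain ⟨s, rfl⟩ := hy
    exact ⟨r * s, map_mul _ _ _⟩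

variable {v : Module.Basis (Fin 2) (Cinf Fq) (ι → Cinf Fq)} {ω : Cinf Fq}

/-- Independence of v₀, v₁ over ℂ_∞ reduces a relation to r₀ = 0 and r₁ + r₂ω = 0, and ω is not in
ℝ_∞. -/
theorem linearIndependent_frame (hω : ω ^ q ^ 2 = ω) (hω' : ω ^ q ≠ ω) :
    LinearIndependent (Rinf Fq) (frame v ω) := by
  rw [Fintype.linearIndependent_iff]
  intro r hr
  have h1 : ∑ k, (![algebraMap (Rinf Fq) (Cinf Fq) (r 0),
      algebraMap (Rinf Fq) (Cinf Fq) (r 1) + algebraMap (Rinf Fq) (Cinf Fq) (r 2) * ω] k) •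
        v k = 0 := by
    rw [← hr]
    simp only [Fin.sum_univ_two, Fin.sum_univ_three, frame, Matrix.cons_val_zero,
      Matrix.cons_val_one, Matrix.cons_val]
    rw [add_smul, mul_smul, add_assoc]
    simp only [algebraMap_smul]
  have h2 := Fintype.linearIndependent_iff.1 v.linearIndependent _ h1
  have h3 := h2 0
  have h4 := h2 1
  simp only [Matrix.cons_val_zero, Matrix.cons_val_one] at h3 h4
  have hinj := (algebraMap (Rinf Fq) (Cinf Fq)).injective
  have hr0 : r 0 = 0 := hinj (by rw [h3, map_zero])
  have hr2 : r 2 = 0 := by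
    by_contra hne
    refine algebraMap_ne_of_pow hω hω' (-r 1 / r 2) ?_
    have hne' : algebraMap (Rinf Fq) (Cinf Fq) (r 2) ≠ 0 := by
      rwa [Ne, map_eq_zero]
    rw [map_div₀, map_neg, div_eq_iff hne']
    linear_combination -h4
  have hr1 : r 1 = 0 := by
    rw [hr2, map_zero, zero_mul, add_zero] at h4
    exact hinj (by rw [h4, map_zero])
  intro k
  fin_cases k
  exacts [hr0, hr1, hr2]

variable {L : Submodule (FqTheta Fq) (ι → Cinf Fq)}

theorem IsFramed.frame_mem (hL : IsFramed L ω v) (k : Fin 3) : frame v ω k ∈ L := by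
  classical
  refine (hL _).2 ⟨Pi.single k 1, ?_⟩
  rw [Finset.sum_eq_single k]
  · simp
  · intro j _ hj
    simp [hj]
  · simp

theorem IsFramed.exists_basis (hL : IsFramed L ω v) (hω : ω ^ q ^ 2 = ω) (hω' : ω ^ q ≠ ω) :
    ∃ b : Module.Basis (Fin 3) (FqTheta Fq) L, ∀ k, (b k : ι → Cinf Fq) = frame v ω k := by
  let w : Fin 3 → L := fun k => ⟨frame v ω k, hL.frame_mem k⟩
  have hli : LinearIndependent (FqTheta Fq) w := by
    rw [Fintype.linearIndependent_iff]
    intro c hc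
    choose r hr using fun k => exists_algebraMap_eq_of_mem_FqTheta (c k).2
    have h1 : ∑ k, r k • frame v ω k = 0 := by
      have h2 := congr_arg (Subtype.val : L → ι → Cinf Fq) hc
      rw [Submodule.coe_sum] at h2
      refine Eq.trans (Finset.sum_congr rfl fun k _ => ?_) h2
      rw [← algebraMap_smul (Cinf Fq) (r k), hr]
      rfl
    have h3 := Fintype.linearIndependent_iff.1 (linearIndependent_frame hω hω') r h1
    intro k
    apply Subtype.ext
    rw [← hr, h3, map_zero]
    rfl
  have hsp : ⊤ ≤ Submodule.span (FqTheta Fq) (Set.range w) := by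
    rintro ⟨Z, hZ⟩ -
    obtain ⟨c, hc⟩ := (hL Z).1 hZ
    have : (⟨Z, hZ⟩ : L) = ∑ k, c k • w k := by
      apply Subtype.ext
      rw [Submodule.coe_sum]
      exact hc
    rw [this]
    exact Submodule.sum_mem _ fun k _ => Submodule.smul_mem _ _ (Submodule.subset_span ⟨k, rfl⟩)
  exact ⟨Module.Basis.mk hli hsp, fun k => by rw [Module.Basis.mk_apply]⟩

theorem IsFramed.isLattice (hL : IsFramed L ω v) (hω : ω ^ q ^ 2 = ω) (hω' : ω ^ q ≠ ω) :
    IsLattice L 3 := by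
  obtain ⟨b, hb⟩ := hL.exists_basis hω hω'
  refine ⟨?_, b, ?_⟩
  · rw [eq_top_iff, ← v.span_eq]
    refine Submodule.span_mono ?_
    rintro _ ⟨k, rfl⟩
    fin_cases k
    · exact hL.frame_mem 0
    · exact hL.frame_mem 1
  · simp only [hb]
    exact linearIndependent_frame hω hω'

theorem IsFramed.rank_eq (hL : IsFramed L ω v) (hω : ω ^ q ^ 2 = ω) (hω' : ω ^ q ≠ ω) :
    Module.rank (FqTheta Fq) L = (3 : ℕ) := by
  obtain ⟨b, -⟩ := hL.exists_basis hω hω'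
  rw [rank_eq_card_basis b, Fintype.card_fin]

theorem IsFramed.hasSiegelMatrix (hL : IsFramed L ω v) (hω : ω ^ q ^ 2 = ω)
    (hω' : ω ^ q ≠ ω) : HasSiegelMatrix L !![0, ω] := by
  obtain ⟨b, hb⟩ := hL.exists_basis hω hω'
  refine ⟨b.reindex (finSumFinEquiv (m := 2) (n := 1)).symm, v, ?_, ?_⟩
  · intro i
    rw [Module.Basis.reindex_apply, Equiv.symm_symm, hb]
    fin_cases i <;> rfl
  · intro k
    rw [Module.Basis.reindex_apply, Equiv.symm_symm, hb]
    fin_cases k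
    rw [Fin.sum_univ_two]
    change ω • v 1 = (0 : Cinf Fq) • v 0 + ω • v 1
    rw [zero_smul, zero_add]

/-- Both frames use the same ω, so the linear map taking v to v' takes one frame to the other. -/
theorem IsFramed.latticeIso {L' : Submodule (FqTheta Fq) (κ → Cinf Fq)}
    {v' : Module.Basis (Fin 2) (Cinf Fq) (κ → Cinf Fq)} (hL : IsFramed L ω v)
    (hL' : IsFramed L' ω v') : LatticeIso L L' := by
  refine ⟨v.equiv v' (Equiv.refl _), ?_⟩
  have hφ : ∀ k, v.equiv v' (Equiv.refl _) (frame v ω k) = frame v' ω k := by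
    intro k
    fin_cases k <;> simp [frame]
  have hsum : ∀ c : Fin 3 → FqTheta Fq,
      v.equiv v' (Equiv.refl _) (∑ k, c k • frame v ω k) = ∑ k, c k • frame v' ω k := by
    intro c
    rw [map_sum]
    refine Finset.sum_congr rfl fun k _ => ?_
    rw [← hφ]
    exact map_smul (v.equiv v' (Equiv.refl _)) (c k : Cinf Fq) (frame v ω k)
  ext Y
  constructor
  · rintro ⟨Z, hZ, rfl⟩
    obtain ⟨c, rfl⟩ := (hL Z).1 hZ
    exact (hL' _).2 ⟨c, hsum c⟩
  · intro hY
    obtain ⟨c, rfl⟩ := (hL' Y).1 hY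
    exact ⟨_, (hL _).2 ⟨c, rfl⟩, hsum c⟩

end Frames

/-! ### The lattices of extensions of the Carlitz module of rank 2 by the Carlitz module -/

section ExtensionLattice

variable {Fq : Type*} [Field Fq] [Fintype Fq]

local notation "q" => Fintype.card Fq

/-- The triangular basis `(x, ϖ₁), (ϖ₂, 0)`. -/
theorem exists_triangular_basis {K : Type*} [Field K] {ι : Type*} {i₁ i₂ : ι} (hne : i₁ ≠ i₂)
    (hor : ∀ i, i = i₁ ∨ i = i₂) (x : K) {ϖ₁ ϖ₂ : K} (h₁ : ϖ₁ ≠ 0) (h₂ : ϖ₂ ≠ 0) :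
    ∃ v : Module.Basis (Fin 2) K (ι → K),
      v 0 i₁ = x ∧ v 0 i₂ = ϖ₁ ∧ v 1 i₁ = ϖ₂ ∧ v 1 i₂ = 0 := by
  classical
  let w : Fin 2 → ι → K :=
    ![fun i => if i = i₁ then x else ϖ₁, fun i => if i = i₁ then ϖ₂ else 0]
  have hw : w 0 i₁ = x ∧ w 0 i₂ = ϖ₁ ∧ w 1 i₁ = ϖ₂ ∧ w 1 i₂ = 0 := by
    simp [w, hne.symm]
  have hli : LinearIndependent K w := by
    rw [Fintype.linearIndependent_iff]
    intro c hc
    rw [Fin.sum_univ_two] at hc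
    have hc₂ : c 0 * w 0 i₂ + c 1 * w 1 i₂ = 0 := congr_fun hc i₂
    have hc₁ : c 0 * w 0 i₁ + c 1 * w 1 i₁ = 0 := congr_fun hc i₁
    rw [hw.2.1, hw.2.2.2, mul_zero, add_zero] at hc₂
    have h0 : c 0 = 0 := (mul_eq_zero.1 hc₂).resolve_right h₁
    rw [hw.2.2.1, h0, zero_mul, zero_add] at hc₁
    have h1 : c 1 = 0 := (mul_eq_zero.1 hc₁).resolve_right h₂
    intro k
    fin_cases k
    exacts [h0, h1]
  have hsp : ⊤ ≤ Submodule.span K (Set.range w) := by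
    intro Z _
    have hZ : Z = (Z i₂ / ϖ₁) • w 0 + ((Z i₁ - Z i₂ / ϖ₁ * x) / ϖ₂) • w 1 := by
      funext i
      rw [Pi.add_apply, Pi.smul_apply, Pi.smul_apply, smul_eq_mul, smul_eq_mul]
      rcases hor i with rfl | rfl
      · rw [hw.1, hw.2.2.1]; field_simp; ring
      · rw [hw.2.1, hw.2.2.2]; field_simp; ring
    rw [hZ]
    exact Submodule.add_mem _ (Submodule.smul_mem _ _ (Submodule.subset_span ⟨0, rfl⟩))
      (Submodule.smul_mem _ _ (Submodule.subset_span ⟨1, rfl⟩))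
  refine ⟨Module.Basis.mk hli hsp, ?_⟩
  simpa only [Module.Basis.mk_apply] using hw

variable {M : Type*} [AddCommGroup M] [Module (Twisted Fq) M] [Module (AndersonRing Fq) M]
  {ι : Type*} [Fintype ι] [DecidableEq ι]
  {e : Module.Basis ι (Twisted Fq) M} {i₁ i₂ : ι} {a : Cinf Fq}

theorem extExp_zero_right : extExp a 0 = 0 := frobSeries_zero _

theorem theta_mem_FqTheta : theta Fq ∈ FqTheta Fq := Algebra.subset_adjoin rfl

/-- The lattice is generated by `(x, ϖ₁)`, `(ϖ₂, 0)`, `(ω ϖ₂, 0)`, with periods `ϖ₁`, `ϖ₂` of the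
two Carlitz modules, if `(x, ϖ₁)` belongs to it. -/
theorem IsExtensionBasis.isFramed (h : IsExtensionBasis e i₁ i₂ a) (ha : ‖a‖ ≤ 1)
    {ω : Cinf Fq} (hω : ω ^ q ^ 2 = ω) (hω' : ω ^ q ≠ ω)
    {ϖ₁ ϖ₂ x : Cinf Fq}
    (hϖ₁ : carlitzExp Fq (theta Fq) 1 ϖ₁ = 0)
    (hper₁ : ∀ S : Set (Cinf Fq), (0 : Cinf Fq) ∈ S →
      (∀ l : Cinf Fq, l ^ q ^ 1 = l → ∀ c ∈ S, l + theta Fq * c ∈ S) →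
      ∀ z, carlitzExp Fq (theta Fq) 1 z = 0 → ∃ c ∈ S, z = c * ϖ₁)
    (hϖ₂ : carlitzExp Fq (theta Fq) 2 ϖ₂ = 0)
    (hper₂ : ∀ S : Set (Cinf Fq), (0 : Cinf Fq) ∈ S →
      (∀ l : Cinf Fq, l ^ q ^ 2 = l → ∀ c ∈ S, l + theta Fq * c ∈ S) →
      ∀ z, carlitzExp Fq (theta Fq) 2 z = 0 → ∃ c ∈ S, z = c * ϖ₂)
    (hx : carlitzExp Fq (theta Fq) 2 x + extExp a ϖ₁ = 0)
    {v : Module.Basis (Fin 2) (Cinf Fq) (ι → Cinf Fq)}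
    (hv : v 0 i₁ = x ∧ v 0 i₂ = ϖ₁ ∧ v 1 i₁ = ϖ₂ ∧ v 1 i₂ = 0) :
    IsFramed (lattice e) ω v := by
  have hN := one_lt_norm_theta (Fq := Fq)
  obtain ⟨hv1, hv2, hv3, hv4⟩ := hv
  have hmem : ∀ k, frame v ω k ∈ lattice e := by
    intro k
    rw [h.mem_lattice ha]
    fin_cases k
    · simpa [frame, hv1, hv2] using ⟨hx, hϖ₁⟩
    · simp [frame, hv3, hv4, hϖ₂, carlitzExp_zero, extExp_zero_right]
    · simp [frame, hv3, hv4, hϖ₂, carlitzExp_zero, extExp_zero_right,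
        carlitzExp_mul hN two_pos hω]
  intro Z
  constructor
  · intro hZ
    obtain ⟨α, hα, hZα⟩ := hper₁ (FqTheta Fq) (zero_mem _) (fun l hl c hc => by
      rw [pow_one] at hl
      obtain ⟨d, rfl⟩ := exists_algebraMap_eq hl
      exact add_mem (Subalgebra.algebraMap_mem _ d) (mul_mem theta_mem_FqTheta hc))
      (Z i₂) ((h.mem_lattice ha Z).1 hZ).2
    -- Subtracting α(x, ϖ₁) kills the second coordinate; the first is then a zero of the rank 2
    -- exponential, hence (β + γω)ϖ₂.
    have hY := (h.mem_lattice ha _).1 (Submodule.sub_mem _ hZ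
      (Submodule.smul_mem _ (⟨α, hα⟩ : FqTheta Fq) (hmem 0)))
    have hY1 : (Z - (⟨α, hα⟩ : FqTheta Fq) • frame v ω 0) i₁ = Z i₁ - α * x := by
      rw [← hv1]; rfl
    have hY2 : (Z - (⟨α, hα⟩ : FqTheta Fq) • frame v ω 0) i₂ = 0 := by
      rw [← sub_eq_zero.2 hZα, ← hv2]; rfl
    rw [hY1, hY2, extExp_zero_right, add_zero] at hY
    obtain ⟨_, ⟨β, hβ, γ, hγ, rfl⟩, hZβ⟩ := hper₂
      {c | ∃ β ∈ FqTheta Fq, ∃ γ ∈ FqTheta Fq, c = β + γ * ω}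
      ⟨0, zero_mem _, 0, zero_mem _, by ring⟩ (by
        rintro l hl _ ⟨β, hβ, γ, hγ, rfl⟩
        obtain ⟨d, d', rfl⟩ := exists_algebraMap_add_mul_eq hω hω' hl
        exact ⟨_, add_mem (Subalgebra.algebraMap_mem _ d) (mul_mem theta_mem_FqTheta hβ),
          _, add_mem (Subalgebra.algebraMap_mem _ d') (mul_mem theta_mem_FqTheta hγ),
          by ring⟩) _ hY.1
    refine ⟨![⟨α, hα⟩, ⟨β, hβ⟩, ⟨γ, hγ⟩], ?_⟩
    rw [Fin.sum_univ_three]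
    funext i
    change Z i = α * v 0 i + β * v 1 i + γ * (ω * v 1 i)
    rcases h.eq_or i with rfl | rfl
    · rw [hv1, hv3]; linear_combination hZβ
    · rw [hv2, hv4]; linear_combination hZα
  · rintro ⟨c, rfl⟩
    exact Submodule.sum_mem _ fun k _ => Submodule.smul_mem _ _ (hmem k)

variable (Fq) in
/-- For small `a`, the lattice of an extension with parameter `a` is framed. -/
theorem exists_forall_isFramed : ∃ ε : ℝ, 0 < ε ∧ ∀ a : Cinf Fq, ‖a‖ ≤ ε →
    ∀ (M : Type*) [AddCommGroup M] [Module (Twisted Fq) M] [Module (AndersonRing Fq) M]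
      (ι : Type*) [Fintype ι] [DecidableEq ι] (e : Module.Basis ι (Twisted Fq) M) (i₁ i₂ : ι),
      IsExtensionBasis e i₁ i₂ a → ∀ ω : Cinf Fq, ω ^ q ^ 2 = ω → ω ^ q ≠ ω →
      ∃ v, IsFramed (lattice e) ω v := by
  have hN := one_lt_norm_theta (Fq := Fq)
  obtain ⟨ρ₁, hρ₁0, hρ₁⟩ := exists_pow_eq_neg_theta_mul (Fq := Fq) one_pos
  obtain ⟨ρ₂, hρ₂0, hρ₂⟩ := exists_pow_eq_neg_theta_mul (Fq := Fq) two_pos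
  obtain ⟨ϖ₁, hϖ₁0, hϖ₁, hper₁⟩ := exists_period hN one_pos hρ₁0 hρ₁
  obtain ⟨ϖ₂, hϖ₂0, hϖ₂, hper₂⟩ := exists_period hN two_pos hρ₂0 hρ₂
  obtain ⟨B, hB0, hB⟩ := exists_norm_extExp_le ϖ₁
  have hρ₂' : 0 < ‖ρ₂‖ := norm_pos_iff.2 hρ₂0
  -- The bound 1 serves the coefficient estimates; `‖ρ₂‖ / B` puts `-extExp a ϖ₁` in the ball that
  -- the rank 2 exponential covers. Neither depends on ω or on the module.
  refine ⟨min 1 (‖ρ₂‖ / B), by positivity, ?_⟩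
  intro a ha M _ _ _ ι _ _ e i₁ i₂ h ω hω hω'
  have ha1 : ‖a‖ ≤ 1 := ha.trans (min_le_left _ _)
  have ha2 : ‖-extExp a ϖ₁‖ ≤ ‖ρ₂‖ := by
    rw [norm_neg]
    refine (hB a ha1).trans ?_
    rw [← le_div_iff₀ hB0]
    exact ha.trans (min_le_right _ _)
  obtain ⟨x, -, hx⟩ := exists_carlitzExp_eq hN two_pos hρ₂0 hρ₂ ha2
  obtain ⟨v, hv⟩ := exists_triangular_basis h.ne h.eq_or x hϖ₁0 hϖ₂0
  exact ⟨v, h.isFramed ha1 hω hω' hϖ₁ hper₁ hϖ₂ hper₂ (by rw [hx, neg_add_cancel]) hv⟩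

end ExtensionLattice

/-! ### Modules over polynomial rings -/

section PolynomialModule

variable {R : Type*} [Ring R] {M N : Type*} [AddCommGroup M] [Module R[X] M]
  [AddCommGroup N] [Module R[X] N]

/-- An additive map commuting with the constants and with the variable is linear. -/
def polynomialLinearMap (F : M →+ N)
    (hC : ∀ (c : R) (m : M), F ((C c : R[X]) • m) = (C c : R[X]) • F m)
    (hX : ∀ m : M, F ((X : R[X]) • m) = (X : R[X]) • F m) : M →ₗ[R[X]] N where
  toFun := F
  map_add' := F.map_add
  map_smul' p m := by
    rw [RingHom.id_apply]
    induction p using Polynomial.induction_on' generalizing m with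
    | add p p' h h' => rw [add_smul, map_add, h, h', add_smul]
    | monomial n c =>
      have hXn : ∀ m : M, F ((X ^ n : R[X]) • m) = (X ^ n : R[X]) • F m := by
        induction n with
        | zero => simp
        | succ n ih => intro m; rw [pow_succ, mul_smul, ih, hX, ← mul_smul]
      rw [← C_mul_X_pow_eq_monomial, mul_smul, hC, hXn, mul_smul]

end PolynomialModule

/-! ### Twisted polynomials -/

section TwistedPolynomials

variable {Fq : Type*} [Field Fq] [Fintype Fq]

local notation "q" => Fintype.card Fq

theorem const_eq (c : Cinf Fq) : const c = SkewPolynomial.monomial 0 c := rfl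

theorem tau_pow_eq (k : ℕ) : tau Fq ^ k = SkewPolynomial.monomial k 1 :=
  (SkewPolynomial.monomial_one_right_eq_X_pow k).symm

theorem monomial_mul_monomial_pow (m n : ℕ) (b c : Cinf Fq) :
    (SkewPolynomial.monomial m b * SkewPolynomial.monomial n c : Twisted Fq) =
      SkewPolynomial.monomial (m + n) (b * c ^ q ^ m) := by
  rw [SkewPolynomial.monomial_mul_monomial, SkewPolynomial.φ_iterate_apply]
  rfl

theorem const_mul_monomial (n : ℕ) (b c : Cinf Fq) :
    const b * SkewPolynomial.monomial n c = SkewPolynomial.monomial n (b * c) := by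
  rw [const_eq, monomial_mul_monomial_pow, zero_add, pow_zero, pow_one]

theorem monomial_mul_const (n : ℕ) (b c : Cinf Fq) :
    SkewPolynomial.monomial n b * const c = SkewPolynomial.monomial n (b * c ^ q ^ n) := by
  rw [const_eq, monomial_mul_monomial_pow, add_zero]

theorem monomial_mul_tau_pow (n k : ℕ) (b : Cinf Fq) :
    SkewPolynomial.monomial n b * tau Fq ^ k = SkewPolynomial.monomial (n + k) b := by
  rw [tau_pow_eq, monomial_mul_monomial_pow, one_pow, mul_one]

theorem monomial_mul_tau (n : ℕ) (b : Cinf Fq) :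
    SkewPolynomial.monomial n b * tau Fq = SkewPolynomial.monomial (n + 1) b := by
  rw [← pow_one (tau Fq), monomial_mul_tau_pow]

theorem twistedEval_add (f g : Twisted Fq) (z : Cinf Fq) :
    twistedEval (f + g) z = twistedEval f z + twistedEval g z :=
  SkewPolynomial.sum_add_index _ _ _ (fun _ => zero_mul _) fun _ _ _ => add_mul _ _ _

theorem twistedEval_monomial (n : ℕ) (c z : Cinf Fq) :
    twistedEval (SkewPolynomial.monomial n c) z = c * z ^ q ^ n :=
  SkewPolynomial.sum_monomial_index (zero_mul _)

theorem twistedEval_zero (z : Cinf Fq) : twistedEval 0 z = 0 := by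
  simp [twistedEval, SkewPolynomial.sum_def]

theorem twistedEval_const_add_tau_pow (c z : Cinf Fq) (k : ℕ) :
    twistedEval (const c + tau Fq ^ k) z = c * z + z ^ q ^ k := by
  rw [twistedEval_add, const_eq, tau_pow_eq, twistedEval_monomial, twistedEval_monomial, pow_zero,
    pow_one, one_mul]

theorem twistedEval_const_add_tau (c z : Cinf Fq) :
    twistedEval (const c + tau Fq) z = c * z + z ^ q := by
  have := twistedEval_const_add_tau_pow c z 1
  rwa [pow_one, pow_one] at this

theorem twistedEval_const_mul_tau (c z : Cinf Fq) :
    twistedEval (const c * tau Fq) z = c * z ^ q := by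
  rw [const_eq, monomial_mul_tau, twistedEval_monomial, zero_add, pow_one]

/-- A monomial of positive degree is a left multiple of `τ`, since `ℂ_∞` is perfect. -/
theorem tau_dvd_monomial_succ (n : ℕ) (c : Cinf Fq) :
    tau Fq ∣ SkewPolynomial.monomial (n + 1) c := by
  obtain ⟨d, rfl⟩ := exists_pow_card_eq c
  refine ⟨SkewPolynomial.monomial n d, ?_⟩
  rw [← pow_one (tau Fq), tau_pow_eq, monomial_mul_monomial_pow, one_mul, pow_one, add_comm]

/-- Here `∣` means that τ is a left factor, which is what membership in τ M requires of each
coordinate. -/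
theorem tau_dvd_mul_tau (f : Twisted Fq) : tau Fq ∣ f * tau Fq := by
  induction f using SkewPolynomial.induction with
  | h0 => rw [zero_mul]; exact dvd_zero _
  | ha n c f _ _ ih =>
    rw [add_mul, monomial_mul_tau]
    exact dvd_add (tau_dvd_monomial_succ n c) ih

/-- The two products have the same constant term, and monomials of positive degree are left
multiples of τ. -/
theorem tau_dvd_mul_const_sub (c : Cinf Fq) (f : Twisted Fq) :
    tau Fq ∣ f * const c - const c * f := by
  induction f using SkewPolynomial.induction with
  | h0 => rw [zero_mul, mul_zero, sub_zero]; exact dvd_zero _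
  | ha n b f _ _ ih =>
    rw [add_mul, mul_add, add_sub_add_comm, monomial_mul_const, const_mul_monomial,
      ← SkewPolynomial.monomial_sub]
    refine dvd_add ?_ ih
    rcases n with - | n
    · rw [pow_zero, pow_one, mul_comm, sub_self, SkewPolynomial.monomial_zero_right]
      exact dvd_zero _
    · exact tau_dvd_monomial_succ n _

/-- The additive map `∑ cₙ τⁿ ↦ ∑ cₙ Vₙ`. -/
def sumHom {N : Type*} [AddCommGroup N] [Module (Cinf Fq) N] (V : ℕ → N) : Twisted Fq →+ N where
  toFun f := SkewPolynomial.sum f fun n c => c • V n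
  map_zero' := by simp [SkewPolynomial.sum_def]
  map_add' f g := SkewPolynomial.sum_add_index _ _ _ (fun _ => zero_smul _ _)
    fun _ _ _ => add_smul _ _ _

theorem sumHom_monomial {N : Type*} [AddCommGroup N] [Module (Cinf Fq) N] (V : ℕ → N) (n : ℕ)
    (c : Cinf Fq) : sumHom V (SkewPolynomial.monomial n c) = c • V n :=
  SkewPolynomial.sum_monomial_index (h := fun n c => c • V n) (zero_smul _ _)

theorem sumHom_const_mul {N : Type*} [AddCommGroup N] [Module (Cinf Fq) N] (V : ℕ → N)
    (c : Cinf Fq) (f : Twisted Fq) : sumHom V (const c * f) = c • sumHom V f := by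
  induction f using SkewPolynomial.induction with
  | h0 => rw [mul_zero, map_zero, smul_zero]
  | ha n b f _ _ ih =>
    rw [mul_add, map_add, map_add, ih, const_mul_monomial, sumHom_monomial, sumHom_monomial,
      smul_add, mul_smul]

end TwistedPolynomials

/-! ### The t-motive `M(a)` -/

section MotiveMa

variable {Fq : Type*} [Field Fq] [Fintype Fq]

local notation "q" => Fintype.card Fq

section General

variable {ι : Type*} [Fintype ι] [DecidableEq ι] (P : Matrix ι ι (Twisted Fq))

theorem Motive.basis_repr (m : Motive P) (k : ι) : (Motive.basis P).repr m k = m k := rfl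

theorem Motive.basis_apply (j : ι) : Motive.basis P j = (Pi.single j 1 : ι → Twisted Fq) := by
  apply (Motive.basis P).repr.injective
  ext1 k
  rw [Module.Basis.repr_self]
  change _ = (Pi.single j 1 : ι → Twisted Fq) k
  rw [Finsupp.single_apply, Pi.single_apply]
  simp only [eq_comm]

theorem Motive.matT_basis : matT (Motive.basis P) = P := by
  ext1 j k
  rw [matT, Matrix.of_apply, Motive.basis_repr, Motive.T_smul, Motive.basis_apply]
  exact congr_fun (Matrix.single_one_vecMul j P) k

end General

/-- The element `f e₁ + g e₂` of `M(a)`. -/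
def Ma.mk (a : Cinf Fq) (f g : Twisted Fq) : Ma a := (![f, g] : Fin 2 → Twisted Fq)

variable {a : Cinf Fq}

theorem Ma.eq_mk (m : Ma a) : m = Ma.mk a (m 0) (m 1) := by
  funext k
  fin_cases k <;> rfl

theorem Ma.mk_zero : Ma.mk a 0 0 = 0 := by
  funext k
  fin_cases k <;> rfl

theorem Ma.mk_add (f g f' g' : Twisted Fq) :
    Ma.mk a (f + f') (g + g') = Ma.mk a f g + Ma.mk a f' g' := by
  funext k
  fin_cases k <;> rfl

theorem Ma.smul_mk (c f g : Twisted Fq) : c • Ma.mk a f g = Ma.mk a (c * f) (c * g) := by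
  funext k
  fin_cases k <;> rfl

theorem Ma.sub_mk (f g f' g' : Twisted Fq) :
    Ma.mk a f g - Ma.mk a f' g' = Ma.mk a (f - f') (g - g') := by
  funext k
  fin_cases k <;> rfl

theorem Ma.T_smul_mk (f g : Twisted Fq) :
    T Fq • Ma.mk a f g = Ma.mk a (f * (const (theta Fq) + tau Fq ^ 2))
      (f * (const a * tau Fq) + g * (const (theta Fq) + tau Fq)) := by
  rw [Motive.T_smul]
  funext k
  change Matrix.vecMul ![f, g] _ k = _
  rw [Matrix.vecMul, dotProduct, Fin.sum_univ_two]
  fin_cases k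
  · change f * _ + g * 0 = _
    rw [mul_zero, add_zero]
    rfl
  · rfl

theorem isExtensionBasis_basisMa : IsExtensionBasis (basisMa a) 0 1 a where
  ne := by decide
  eq_or i := by fin_cases i <;> simp
  actT_fst Z := by
    have h1 : matT (basisMa a) 0 0 = const (theta Fq) + tau Fq ^ 2 :=
      congr_fun (congr_fun (Motive.matT_basis _) 0) 0
    have h2 : matT (basisMa a) 0 1 = const a * tau Fq :=
      congr_fun (congr_fun (Motive.matT_basis _) 0) 1
    rw [actT, Fin.sum_univ_two, h1, h2, twistedEval_const_add_tau_pow, twistedEval_const_mul_tau]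
  actT_snd Z := by
    have h1 : matT (basisMa a) 1 0 = 0 := congr_fun (congr_fun (Motive.matT_basis _) 1) 0
    have h2 : matT (basisMa a) 1 1 = const (theta Fq) + tau Fq :=
      congr_fun (congr_fun (Motive.matT_basis _) 1) 1
    rw [actT, Fin.sum_univ_two, h1, h2, twistedEval_const_add_tau, twistedEval_zero, zero_add]

variable (Fq) in
theorem isExtensionBasis_basis0 : IsExtensionBasis (basis0 Fq) (Sum.inl 0) (Sum.inr 0) 0 where
  ne := by decide
  eq_or i := by
    rcases i with i | i
    · exact Or.inl (by rw [Subsingleton.elim i 0])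
    · exact Or.inr (by rw [Subsingleton.elim i 0])
  actT_fst Z := by
    have h1 : matT (basis0 Fq) (Sum.inl 0) (Sum.inl 0) = const (theta Fq) + tau Fq ^ 2 := by
      have := congr_fun (congr_fun (Motive.matT_basis !![const (theta Fq) + tau Fq ^ 2]) 0) 0
      simpa [matT, basis0] using this
    have h2 : matT (basis0 Fq) (Sum.inl 0) (Sum.inr 0) = 0 := by
      simp [matT, basis0]
    rw [actT, Fintype.sum_sum_type, Fin.sum_univ_one, Fin.sum_univ_one, h1, h2,
      twistedEval_const_add_tau_pow, twistedEval_zero, zero_mul]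
  actT_snd Z := by
    have h1 : matT (basis0 Fq) (Sum.inr 0) (Sum.inr 0) = const (theta Fq) + tau Fq := by
      have := congr_fun (congr_fun (Motive.matT_basis !![const (theta Fq) + tau Fq]) 0) 0
      simpa [matT, basis0] using this
    have h2 : matT (basis0 Fq) (Sum.inr 0) (Sum.inl 0) = 0 := by
      simp [matT, basis0]
    rw [actT, Fintype.sum_sum_type, Fin.sum_univ_one, Fin.sum_univ_one, h1, h2,
      twistedEval_const_add_tau, twistedEval_zero, zero_add]

/-! ### `M(a)` is free over `ℂ_∞[T]` -/

variable (Fq) in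
/-- The coordinates of `τ ^ n e₂` in the basis `e₁, τ e₁, e₂` of `M(a)` over `ℂ_∞[T]`. -/
def coordSnd : ℕ → Fin 3 → (Cinf Fq)[X]
  | 0 => ![0, 0, 1]
  | n + 1 => (X - Polynomial.C (theta Fq ^ q ^ n)) • coordSnd n

/-- The coordinates of `τ ^ n e₁` in the basis `e₁, τ e₁, e₂` of `M(a)` over `ℂ_∞[T]`. -/
def coordFst (a : Cinf Fq) : ℕ → Fin 3 → (Cinf Fq)[X]
  | 0 => ![1, 0, 0]
  | 1 => ![0, 1, 0]
  | n + 2 => (X - Polynomial.C (theta Fq ^ q ^ n)) • coordFst a n -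
      Polynomial.C (a ^ q ^ n) • coordSnd Fq (n + 1)

variable (a) in
/-- The coordinates of the elements of `M(a)` in the basis `e₁, τ e₁, e₂` over `ℂ_∞[T]`. -/
def coordHom : Ma a →+ (Fin 3 → (Cinf Fq)[X]) where
  toFun m := sumHom (coordFst a) (m 0) + sumHom (coordSnd Fq) (m 1)
  map_zero' := by
    change sumHom (coordFst a) 0 + sumHom (coordSnd Fq) 0 = 0
    rw [map_zero, map_zero, add_zero]
  map_add' m m' := by
    change sumHom (coordFst a) (m 0 + m' 0) + sumHom (coordSnd Fq) (m 1 + m' 1) = _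
    rw [map_add, map_add, add_add_add_comm]

theorem coordHom_mk (f g : Twisted Fq) :
    coordHom a (Ma.mk a f g) = sumHom (coordFst a) f + sumHom (coordSnd Fq) g := rfl

/-- Applying τⁿ to T e₂ = θ e₂ + τ e₂ gives τⁿ⁺¹ e₂ = (T - θ^(qⁿ)) τⁿ e₂, the recursion of
`coordSnd`. -/
theorem sumHom_coordSnd_mul (g : Twisted Fq) :
    sumHom (coordSnd Fq) (g * (const (theta Fq) + tau Fq)) =
      (X : (Cinf Fq)[X]) • sumHom (coordSnd Fq) g := by
  induction g using SkewPolynomial.induction with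
  | h0 => rw [zero_mul, map_zero, smul_zero]
  | ha n c g _ _ ih =>
    rw [add_mul, map_add, map_add, ih, smul_add, mul_add, map_add, monomial_mul_const,
      monomial_mul_tau, sumHom_monomial, sumHom_monomial, sumHom_monomial, coordSnd]
    congr 1
    funext k
    simp only [Pi.add_apply, Pi.smul_apply, smul_eq_mul, Polynomial.smul_eq_C_mul, C_mul]
    ring

/-- Likewise τⁿ⁺² e₁ = (T - θ^(qⁿ)) τⁿ e₁ - a^(qⁿ) τⁿ⁺¹ e₂. With the previous identity this makes
the coordinate map ℂ_∞[T]-linear. -/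
theorem sumHom_coordFst_mul (f : Twisted Fq) :
    sumHom (coordFst a) (f * (const (theta Fq) + tau Fq ^ 2)) +
      sumHom (coordSnd Fq) (f * (const a * tau Fq)) =
      (X : (Cinf Fq)[X]) • sumHom (coordFst a) f := by
  induction f using SkewPolynomial.induction with
  | h0 => rw [zero_mul, zero_mul, map_zero, map_zero, add_zero, smul_zero]
  | ha n c f _ _ ih =>
    rw [add_mul, add_mul, map_add, map_add, map_add, add_add_add_comm, ih, smul_add, mul_add,
      map_add, ← mul_assoc, monomial_mul_const, monomial_mul_const, monomial_mul_tau,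
      monomial_mul_tau_pow, sumHom_monomial, sumHom_monomial, sumHom_monomial, sumHom_monomial,
      coordFst]
    congr 1
    funext k
    simp only [Pi.add_apply, Pi.sub_apply, Pi.smul_apply, smul_eq_mul, Polynomial.smul_eq_C_mul,
      C_mul]
    ring

theorem inclT_C (c : Cinf Fq) : inclT Fq (Polynomial.C c) = Polynomial.C (const c) :=
  Polynomial.map_C _

theorem inclT_X : inclT Fq X = T Fq := Polynomial.map_X _

variable (a) in
theorem Ma.freeOfRankT : FreeOfRankT Fq (Ma a) 3 := by
  unfold FreeOfRankT
  let _ : Module (Cinf Fq)[X] (Ma a) := Module.compHom (Ma a) (inclT Fq)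
  have hCmk : ∀ (c : Cinf Fq) (f g : Twisted Fq), (Polynomial.C c : (Cinf Fq)[X]) • Ma.mk a f g =
      Ma.mk a (const c * f) (const c * g) := by
    intro c f g
    change inclT Fq (Polynomial.C c) • Ma.mk a f g = _
    rw [inclT_C, Motive.C_smul, Ma.smul_mk]
  have hXmk : ∀ (f g : Twisted Fq), (X : (Cinf Fq)[X]) • Ma.mk a f g =
      Ma.mk a (f * (const (theta Fq) + tau Fq ^ 2))
      (f * (const a * tau Fq) + g * (const (theta Fq) + tau Fq)) := by
    intro f g
    change inclT Fq X • Ma.mk a f g = _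
    rw [inclT_X, Ma.T_smul_mk]
  let Φ : Ma a →ₗ[(Cinf Fq)[X]] (Fin 3 → (Cinf Fq)[X]) :=
    polynomialLinearMap (coordHom a)
      (fun c m => by
        rw [m.eq_mk, hCmk, coordHom_mk, coordHom_mk, sumHom_const_mul, sumHom_const_mul,
          ← smul_add]
        funext k
        simp only [Pi.smul_apply, smul_eq_mul, Polynomial.smul_eq_C_mul])
      (fun m => by
        rw [m.eq_mk, hXmk, coordHom_mk, coordHom_mk, map_add, sumHom_coordSnd_mul, ← add_assoc,
          sumHom_coordFst_mul, smul_add])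
  have hΦ : ∀ f g, Φ (Ma.mk a f g) = sumHom (coordFst a) f + sumHom (coordSnd Fq) g :=
    fun f g => rfl
  let mon : ℕ → Cinf Fq → Twisted Fq := fun n c => SkewPolynomial.monomial n c
  let v : Fin 3 → Ma a := ![Ma.mk a (mon 0 1) 0, Ma.mk a (mon 1 1) 0, Ma.mk a 0 (mon 0 1)]
  -- The coordinate map sends e₁, τ e₁, e₂ to the standard basis, so they are independent; the same
  -- recursions, solved for the highest power of τ, show that they generate.
  have hli : LinearIndependent (Cinf Fq)[X] v := by
    apply LinearIndependent.of_comp Φ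
    have h1 : Φ ∘ v = Pi.basisFun (Cinf Fq)[X] (Fin 3) := by
      funext k
      rw [Pi.basisFun_apply]
      fin_cases k
      all_goals
        simp only [Function.comp, v, mon]
        funext j
        fin_cases j <;>
          simp [hΦ, sumHom_monomial, coordFst, coordSnd, -SkewPolynomial.monomial_zero_left]
    rw [h1]
    exact (Pi.basisFun (Cinf Fq)[X] (Fin 3)).linearIndependent
  have hsp : ⊤ ≤ Submodule.span (Cinf Fq)[X] (Set.range v) := by
    set N := Submodule.span (Cinf Fq)[X] (Set.range v)
    have hv : ∀ k, v k ∈ N := fun k => Submodule.subset_span ⟨k, rfl⟩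
    have hsnd : ∀ n, Ma.mk a 0 (mon n 1) ∈ N := by
      intro n
      induction n with
      | zero => exact hv 2
      | succ n ih =>
        have h1 : Ma.mk a 0 (mon (n + 1) 1) = (X : (Cinf Fq)[X]) • Ma.mk a 0 (mon n 1) -
            (Polynomial.C (theta Fq ^ q ^ n) : (Cinf Fq)[X]) • Ma.mk a 0 (mon n 1) := by
          rw [hXmk, hCmk, Ma.sub_mk]
          simp only [mon, mul_add, zero_mul, mul_zero, monomial_mul_const, monomial_mul_tau,
            const_mul_monomial, one_mul, mul_one, zero_add, sub_zero, add_sub_cancel_left]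
        rw [h1]
        exact Submodule.sub_mem _ (Submodule.smul_mem _ _ ih) (Submodule.smul_mem _ _ ih)
    -- The recursion for τⁿ e₁ has step two, so consecutive powers are carried together.
    have hfst : ∀ n, Ma.mk a (mon n 1) 0 ∈ N ∧ Ma.mk a (mon (n + 1) 1) 0 ∈ N := by
      intro n
      induction n with
      | zero => exact ⟨hv 0, hv 1⟩
      | succ n ih =>
        refine ⟨ih.2, ?_⟩
        have h1 : Ma.mk a (mon (n + 1 + 1) 1) 0 = (X : (Cinf Fq)[X]) • Ma.mk a (mon n 1) 0 -
            (Polynomial.C (theta Fq ^ q ^ n) : (Cinf Fq)[X]) • Ma.mk a (mon n 1) 0 -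
            (Polynomial.C (a ^ q ^ n) : (Cinf Fq)[X]) • Ma.mk a 0 (mon (n + 1) 1) := by
          rw [hXmk, hCmk, hCmk, Ma.sub_mk, Ma.sub_mk]
          simp only [mon, mul_add, zero_mul, mul_zero, monomial_mul_const, monomial_mul_tau,
            monomial_mul_tau_pow, const_mul_monomial, one_mul, mul_one, add_zero, sub_zero,
            add_sub_cancel_left, ← mul_assoc, sub_self]
        rw [h1]
        exact Submodule.sub_mem _ (Submodule.sub_mem _ (Submodule.smul_mem _ _ ih.1)
          (Submodule.smul_mem _ _ ih.1)) (Submodule.smul_mem _ _ (hsnd _))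
    have hfst' : ∀ f, Ma.mk a f 0 ∈ N := by
      intro f
      induction f using SkewPolynomial.induction with
      | h0 => rw [Ma.mk_zero]; exact N.zero_mem
      | ha n c f _ _ ih =>
        have h1 : Ma.mk a (SkewPolynomial.monomial n c + f) 0 =
            (Polynomial.C c : (Cinf Fq)[X]) • Ma.mk a (mon n 1) 0 + Ma.mk a f 0 := by
          rw [hCmk, ← Ma.mk_add, const_mul_monomial, mul_one, mul_zero, add_zero]
        rw [h1]
        exact N.add_mem (N.smul_mem _ (hfst n).1) ih
    have hsnd' : ∀ g, Ma.mk a 0 g ∈ N := by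
      intro g
      induction g using SkewPolynomial.induction with
      | h0 => rw [Ma.mk_zero]; exact N.zero_mem
      | ha n c g _ _ ih =>
        have h1 : Ma.mk a 0 (SkewPolynomial.monomial n c + g) =
            (Polynomial.C c : (Cinf Fq)[X]) • Ma.mk a 0 (mon n 1) + Ma.mk a 0 g := by
          rw [hCmk, ← Ma.mk_add, const_mul_monomial, mul_one, mul_zero, add_zero]
        rw [h1]
        exact N.add_mem (N.smul_mem _ (hsnd n)) ih
    intro m _
    have h1 : m = Ma.mk a (m 0) 0 + Ma.mk a 0 (m 1) := by
      rw [← Ma.mk_add, add_zero, zero_add]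
      exact m.eq_mk
    rw [h1]
    exact N.add_mem (hfst' _) (hsnd' _)
  exact ⟨Module.Basis.mk hli hsp⟩

variable (a) in
theorem Ma.isTMotive : IsTMotive Fq (Ma a) 3 2 where
  free_T := Ma.freeOfRankT a
  free_tau := ⟨basisMa a⟩
  nilpotent := by
    -- The matrix A₀ is the scalar θ, so T - θ itself is zero on M / τ M.
    refine ⟨1, fun m => ?_⟩
    obtain ⟨f, g, rfl⟩ : ∃ f g, m = Ma.mk a f g := ⟨_, _, m.eq_mk⟩
    rw [pow_one, sub_smul, Motive.C_smul, Ma.T_smul_mk, Ma.smul_mk, Ma.sub_mk]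
    have h1 : tau Fq ∣ f * (const (theta Fq) + tau Fq ^ 2) - const (theta Fq) * f := by
      rw [mul_add, add_sub_right_comm, pow_two, ← mul_assoc]
      exact dvd_add (tau_dvd_mul_const_sub _ _) (tau_dvd_mul_tau _)
    have h2 : tau Fq ∣ f * (const a * tau Fq) + g * (const (theta Fq) + tau Fq) -
        const (theta Fq) * g := by
      rw [mul_add, ← mul_assoc, add_sub_assoc, add_sub_right_comm]
      exact dvd_add (tau_dvd_mul_tau _) (dvd_add (tau_dvd_mul_const_sub _ _) (tau_dvd_mul_tau _))
    obtain ⟨f', hf'⟩ := h1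
    obtain ⟨g', hg'⟩ := h2
    exact ⟨Ma.mk a f' g', by rw [hf', hg', Ma.smul_mk]⟩

/-! ### The exact sequence -/

theorem Motive.T_smul_apply_of_unique (u : Twisted Fq) (x : Motive (ι := Fin 1) !![u]) :
    (T Fq • x : Motive (ι := Fin 1) !![u]) 0 = x 0 * u := by
  rw [Motive.T_smul]
  change dotProduct (fun i => x i) (fun i => !![u] i 0) = _
  rw [dotProduct, Fin.sum_univ_one]
  rfl

variable (a) in
/-- The inclusion of the Carlitz module in `M(a)`. -/
def Ma.ofCarlitz : Carlitz Fq →ₗ[AndersonRing Fq] Ma a :=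
  polynomialLinearMap
    { toFun x := Ma.mk a 0 (x 0)
      map_zero' := Ma.mk_zero
      map_add' x y := by
        rw [← Ma.mk_add, add_zero]
        rfl }
    (fun c x => by
      rw [Motive.C_smul, Motive.C_smul]
      change Ma.mk a 0 (c * x 0) = c • Ma.mk a 0 (x 0)
      rw [Ma.smul_mk, mul_zero])
    (fun x => by
      change Ma.mk a 0 ((T Fq • x : Carlitz Fq) 0) = T Fq • Ma.mk a 0 (x 0)
      rw [Ma.T_smul_mk, Motive.T_smul_apply_of_unique, zero_mul, zero_mul, zero_add])

variable (a) in
/-- The projection of `M(a)` to the Carlitz module of rank 2. -/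
def Ma.toCarlitz2 : Ma a →ₗ[AndersonRing Fq] Carlitz2 Fq :=
  polynomialLinearMap
    { toFun m := (fun _ => m 0 : Fin 1 → Twisted Fq)
      map_zero' := rfl
      map_add' _ _ := rfl }
    (fun c m => by
      rw [Motive.C_smul, Motive.C_smul]
      rfl)
    (fun m => by
      funext k
      rw [Subsingleton.elim k 0]
      have h1 := Motive.T_smul_apply_of_unique (const (theta Fq) + tau Fq ^ 2)
        (fun _ => m 0 : Fin 1 → Twisted Fq)
      have h2 : (T Fq • m) 0 = m 0 * (const (theta Fq) + tau Fq ^ 2) := by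
        conv_lhs => rw [m.eq_mk, Ma.T_smul_mk]
        rfl
      exact h2.trans h1.symm)

theorem Ma.ofCarlitz_injective : Function.Injective (Ma.ofCarlitz a) := by
  intro x y h
  funext k
  rw [Subsingleton.elim k 0]
  exact congr_fun h (1 : Fin 2)

theorem Ma.exact : Function.Exact (Ma.ofCarlitz a) (Ma.toCarlitz2 a) := by
  intro m
  constructor
  · intro h
    refine ⟨(fun _ => m 1 : Fin 1 → Twisted Fq), ?_⟩
    have h0 : m 0 = 0 := congr_fun h (0 : Fin 1)
    rw [m.eq_mk, h0]
    rfl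
  · rintro ⟨x, rfl⟩
    rfl

theorem Ma.toCarlitz2_surjective : Function.Surjective (Ma.toCarlitz2 a) := by
  intro y
  refine ⟨Ma.mk a (y 0) 0, ?_⟩
  funext k
  rw [Subsingleton.elim k 0]
  rfl

end MotiveMa

end TMot

end

/-! ### Comparison of `M(a)` with the direct sum. -/

theorem proposition2p4 (Fq : Type*) [Field Fq] [Fintype Fq] :
    (∀ a : TMot.Cinf Fq, TMot.IsTMotive Fq (TMot.Ma a) 3 2 ∧
      ∃ (f : TMot.Carlitz Fq →ₗ[TMot.AndersonRing Fq] TMot.Ma a)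
        (g : TMot.Ma a →ₗ[TMot.AndersonRing Fq] TMot.Carlitz2 Fq),
        Function.Injective f ∧ Function.Exact f g ∧ Function.Surjective g) ∧
    TMot.IsLattice (TMot.L0 Fq) 3 ∧
    (∀ ω : TMot.Cinf Fq, ω ^ Fintype.card Fq ^ 2 = ω → ω ^ Fintype.card Fq ≠ ω →
      TMot.HasSiegelMatrix (TMot.L0 Fq) !![0, ω]) ∧
    ∃ U ∈ 𝓝 (0 : TMot.Cinf Fq), ∀ a ∈ U,
      TMot.IsUniformizable (TMot.basisMa a) ∧
      TMot.IsLattice (TMot.lattice (TMot.basisMa a)) 3 ∧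
      TMot.LatticeIso (TMot.lattice (TMot.basisMa a)) (TMot.L0 Fq) := by
  obtain ⟨ε, hε, h⟩ := TMot.exists_forall_isFramed Fq
  obtain ⟨ω, hω, hω'⟩ := TMot.exists_pow_card_sq_eq (Fq := Fq)
  -- The direct sum is the extension with parameter 0. Here ω stays arbitrary, since the Siegel
  -- matrix is claimed for every ω.
  have h0 := h 0 (by simpa using hε.le) _ _ _ _ _ (TMot.isExtensionBasis_basis0 Fq)
  obtain ⟨v₀, hv₀⟩ := h0 ω hω hω'
  refine ⟨fun a => ⟨TMot.Ma.isTMotive a, TMot.Ma.ofCarlitz a, TMot.Ma.toCarlitz2 a,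
    TMot.Ma.ofCarlitz_injective, TMot.Ma.exact, TMot.Ma.toCarlitz2_surjective⟩,
    hv₀.isLattice hω hω', fun ω' h1 h2 => ?_, Metric.closedBall 0 ε,
    Metric.closedBall_mem_nhds 0 hε, fun a ha => ?_⟩
  · obtain ⟨v, hv⟩ := h0 ω' h1 h2
    exact hv.hasSiegelMatrix h1 h2
  · obtain ⟨v, hv⟩ := h a (by simpa using ha) _ _ _ _ _ TMot.isExtensionBasis_basisMa ω hω hω'
    exact ⟨⟨3, TMot.Ma.freeOfRankT a, hv.rank_eq hω hω'⟩, hv.isLattice hω hω',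
      hv.latticeIso hv₀⟩
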